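/- Let $T$ be an infinite, locally finite rooted tree with root $v_0$. Let $\partial T$ be its space of ends, that is, the set of infinite paths $\xi=(\xi_n)_{n\ge 0}$ with $\xi_0=v_0$ such that $\xi_{n+1}$ is a child of $\xi_n$ for every $n$, with the visual metric $d(\xi,\xi')=2^{-N}$ for $\xi\neq\xi'$, where $N$ is the smallest $n$ with $\xi_n\ne\xi'_n$; this is a compact metric space. Let $\mathrm{AAut}(T)$ be the group of almost automorphisms of $T$, i.e. of homeomorphisms $g$ of $\partial T$ for which there are a finite partition of $\partial T$ into balls $D_1,\dots,D_n$ of the form $\partial T_v=\{\xi : v\in\xi\}$ ($v$ a vertex) and numbers $\lambda_1,\dots,\lambda_n>0$ with $d(g(y),g(z))=\lambda_j\,d(y,z)$ for all $y,z\in D_j$ and all $j$. Then the action of $\mathrm{AAut}(T)$ on $\partial T$ satisfies the dynamical Tits alternative: for every subgroup $H\le \mathrm{AAut}(T)$, either $H$ preserves a regular Borel probability measure on $\partial T$, or there is a ping-pong pair $g,h\in H$ on $\partial T$, i.e. there are pairwise disjoint open sets $U_1,U_2,V_1,V_2\subseteq\partial T$ such that $$g(\partial T\setminus U_1)\subseteq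 V_1\quad\text{and}\quad h(\partial T\setminus U_2)\subseteq V_2 .$$ Moreover, any ping-pong pair $g,h\in\mathrm{AAut}(T)$ on $\partial T$ freely generates a free group of rank two. -/

import Mathlib

open MeasureTheory Topology

/-! ### The dynamical Tits alternative -/

section Dynamics

variable {X : Type*} [TopologicalSpace X]

/-- `g, h` is a ping-pong pair on `X`: there are pairwise disjoint open sets `U₁, U₂, V₁, V₂` with
`g (X \ U₁) ⊆ V₁` and `h (X \ U₂) ⊆ V₂`. -/
def IsPingPongPair (g h : X ≃ₜ X) : Prop :=
  ∃ U₁ U₂ V₁ V₂ : Set X,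
    (IsOpen U₁ ∧ IsOpen U₂ ∧ IsOpen V₁ ∧ IsOpen V₂) ∧
    [U₁, U₂, V₁, V₂].Pairwise Disjoint ∧
    g '' U₁ᶜ ⊆ V₁ ∧ h '' U₂ᶜ ⊆ V₂

/-- A group of homeomorphisms of `X` preserves some regular Borel probability measure on `X`. -/
def PreservesRegularProbability [MeasurableSpace X] [BorelSpace X] (H : Subgroup (X ≃ₜ X)) :
    Prop :=
  ∃ μ : Measure X, IsProbabilityMeasure μ ∧ μ.Regular ∧ ∀ h ∈ H, μ.map h = μ

/-- The dynamical Tits alternative for a group `G` of homeomorphisms of a compact space `X`. -/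
def DynamicalTitsAlternative [CompactSpace X] [MeasurableSpace X] [BorelSpace X]
    (G : Subgroup (X ≃ₜ X)) : Prop :=
  ∀ H : Subgroup (X ≃ₜ X), H ≤ G →
    PreservesRegularProbability H ∨ ∃ g ∈ H, ∃ h ∈ H, IsPingPongPair g h

end Dynamics

/-! ### The boundary of a rooted tree

In a `RootedTree` the vertices are ordered by descent from the root `⊥`, and the children of a
vertex `v` are the vertices `w` that cover it, `v ⋖ w`. -/

namespace RootedTree

/-- Every vertex has finitely many children. -/
class LocallyFinite (T : RootedTree) : Prop where
  finite_children : ∀ v : T, {w : T | v ⋖ w}.Finite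

/-- The space of ends `∂T`: infinite directed paths starting at the root. -/
@[ext]
structure Boundary (T : RootedTree) where
  /-- the sequence of vertices of the path -/
  path : ℕ → T
  path_zero : path 0 = ⊥
  path_covBy : ∀ n, path n ⋖ path (n + 1)

namespace Boundary

variable {T : RootedTree}

/-- The visual metric: the distance of `ξ ≠ ξ'` is `(1/2) ^ N`, where `N` is the smallest index
with `ξ N ≠ ξ' N` (this is `PiNat.dist`). The topology is the one given by the metric. -/
noncomputable instance : MetricSpace (Boundary T) where
  dist ξ ξ' := (PiNat.dist (E := fun _ => T)).dist ξ.path ξ'.path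
  dist_self ξ := PiNat.dist_self ξ.path
  dist_comm ξ ξ' := PiNat.dist_comm ξ.path ξ'.path
  dist_triangle ξ ξ' ξ'' := PiNat.dist_triangle ξ.path ξ'.path ξ''.path
  eq_of_dist_eq_zero h := Boundary.ext (PiNat.eq_of_dist_eq_zero _ _ h)

noncomputable instance : MeasurableSpace (Boundary T) := borel _

instance : BorelSpace (Boundary T) := ⟨rfl⟩

/-- The clopen ball `∂T_v` of all ends that pass through the vertex `v`. -/
def ball (v : T) : Set (Boundary T) := {ξ | ∃ n, ξ.path n = v}

theorem dist_def (ξ ξ' : Boundary T) :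
    dist ξ ξ' = (PiNat.dist (E := fun _ => T)).dist ξ.path ξ'.path := rfl

theorem pred_iterate (ξ : Boundary T) (n k : ℕ) : Order.pred^[k] (ξ.path (n + k)) = ξ.path n := by
  induction k with
  | zero => rfl
  | succ k ih =>
    rw [Function.iterate_succ_apply, ← add_assoc, (ξ.path_covBy (n + k)).pred_eq, ih]

theorem eq_of_le {ξ η : Boundary T} {n i : ℕ} (h : η.path n = ξ.path n) (hi : i ≤ n) :
    η.path i = ξ.path i := by
  obtain ⟨k, rfl⟩ := Nat.exists_eq_add_of_le hi
  rw [← pred_iterate η i k, ← pred_iterate ξ i k, h]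

theorem strictMono (ξ : Boundary T) : StrictMono ξ.path :=
  strictMono_nat_of_lt_succ fun n => (ξ.path_covBy n).lt

theorem level_eq {ξ η : Boundary T} {n m : ℕ} (h : η.path m = ξ.path n) : m = n := by
  rcases le_total m n with hmn | hmn
  · obtain ⟨k, rfl⟩ := Nat.exists_eq_add_of_le hmn
    have h1 := pred_iterate η 0 m
    have h2 := pred_iterate ξ k m
    rw [zero_add] at h1
    rw [add_comm k m, ← h, h1, η.path_zero, ← ξ.path_zero] at h2
    have := ξ.strictMono.injective h2
    omega
  · obtain ⟨k, rfl⟩ := Nat.exists_eq_add_of_le hmn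
    have h1 := pred_iterate ξ 0 n
    have h2 := pred_iterate η k n
    rw [zero_add] at h1
    rw [add_comm k n, h, h1, ξ.path_zero, ← η.path_zero] at h2
    have := η.strictMono.injective h2
    omega

theorem mem_ball_iff {ξ η : Boundary T} {n : ℕ} : η ∈ ball (ξ.path n) ↔ η.path n = ξ.path n := by
  constructor
  · rintro ⟨m, hm⟩
    rwa [level_eq hm] at hm
  · exact fun h => ⟨n, h⟩

theorem mem_ball_iff_dist {ξ η : Boundary T} {n : ℕ} :
    η ∈ ball (ξ.path n) ↔ dist η ξ < (1 / 2 : ℝ) ^ n := by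
  rw [mem_ball_iff]
  constructor
  · intro h
    refine lt_of_le_of_lt ((PiNat.mem_cylinder_iff_dist_le (n := n + 1)).1 ?_)
      (pow_lt_pow_right_of_lt_one₀ (by norm_num) (by norm_num) (Nat.lt_succ_self n))
    intro i hi
    exact eq_of_le h (Nat.lt_succ_iff.1 hi)
  · intro h
    exact PiNat.apply_eq_of_dist_lt (E := fun _ => T) h le_rfl

theorem finite_level [T.LocallyFinite] (n : ℕ) :
    (Set.range fun ξ : Boundary T => ξ.path n).Finite := by
  induction n with
  | zero =>
    refine (Set.finite_singleton (⊥ : T)).subset ?_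
    rintro _ ⟨ξ, rfl⟩
    exact ξ.path_zero
  | succ n ih =>
    refine (ih.biUnion fun v _ => LocallyFinite.finite_children v).subset ?_
    rintro _ ⟨ξ, rfl⟩
    exact Set.mem_biUnion ⟨ξ, rfl⟩ (ξ.path_covBy n)

instance [T.LocallyFinite] : CompactSpace (Boundary T) := by
  let _ : TopologicalSpace T := ⊥
  have _ : DiscreteTopology T := ⟨rfl⟩
  have hrange : Set.range (path : Boundary T → ℕ → T) =
      {x | x 0 = ⊥} ∩ ⋂ n, {x | x n ⋖ x (n + 1)} := by
    ext x
    simp only [Set.mem_range, Set.mem_inter_iff, Set.mem_iInter, Set.mem_ofPred_eq]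
    exact ⟨by rintro ⟨ξ, rfl⟩; exact ⟨ξ.path_zero, ξ.path_covBy⟩, fun h => ⟨⟨x, h.1, h.2⟩, rfl⟩⟩
  have hclosed : IsClosed (Set.range (path : Boundary T → ℕ → T)) := by
    rw [hrange]
    refine IsClosed.inter ?_ (isClosed_iInter fun n => ?_)
    · exact (isClosed_discrete ({⊥} : Set T)).preimage
        (continuous_apply (A := fun _ : ℕ => T) 0)
    · exact (isClosed_discrete {p : T × T | p.1 ⋖ p.2}).preimage
        ((continuous_apply (A := fun _ : ℕ => T) n).prodMk
          (continuous_apply (A := fun _ : ℕ => T) (n + 1)))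
  have hcomp : IsCompact (Set.range (path : Boundary T → ℕ → T)) := by
    refine (isCompact_univ_pi fun n => (finite_level (T := T) n).isCompact).of_isClosed_subset
      hclosed ?_
    rintro _ ⟨ξ, rfl⟩ n _
    exact ⟨ξ, rfl⟩
  let _ : MetricSpace (ℕ → T) := PiNat.metricSpace
  have hiso : Isometry (path : Boundary T → ℕ → T) := Isometry.of_dist_eq fun _ _ => rfl
  exact ⟨hiso.isEmbedding.isCompact_iff.2 (by rwa [Set.image_univ])⟩

end Boundary

/-! ### Almost automorphisms -/

open Boundary

variable {T : RootedTree}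

/-- `g` rescales the visual metric on `D` by a positive constant. -/
def IsHomothetyOn (g : Boundary T → Boundary T) (D : Set (Boundary T)) : Prop :=
  ∃ c : ℝ, 0 < c ∧ ∀ y ∈ D, ∀ z ∈ D, dist (g y) (g z) = c * dist y z

/-- `P` is a finite partition of `∂T` into clopen balls on each of which `g` is a homothety. -/
def IsAdmissible (g : Boundary T ≃ₜ Boundary T) (P : Set (Set (Boundary T))) : Prop :=
  P.Finite ∧ Setoid.IsPartition P ∧ ∀ D ∈ P, (∃ v : T, D = ball v) ∧ IsHomothetyOn g D

/-- `g` is an almost automorphism of `T`. -/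
def IsAlmostAutomorphism (g : Boundary T ≃ₜ Boundary T) : Prop :=
  ∃ P, IsAdmissible g P

theorem IsHomothetyOn.mono {g : Boundary T → Boundary T} {D E : Set (Boundary T)}
    (h : IsHomothetyOn g D) (hE : E ⊆ D) : IsHomothetyOn g E := by
  obtain ⟨c, hc, h⟩ := h
  exact ⟨c, hc, fun y hy z hz => h y (hE hy) z (hE hz)⟩

theorem isAlmostAutomorphism_iff [T.LocallyFinite] {g : Boundary T ≃ₜ Boundary T} :
    IsAlmostAutomorphism g ↔ ∀ ξ, ∃ U ∈ 𝓝 ξ, IsHomothetyOn g U := by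
  constructor
  · rintro ⟨P, -, hP, h⟩ ξ
    obtain ⟨D, ⟨hD, hξ⟩, -⟩ := hP.2 ξ
    obtain ⟨⟨v, rfl⟩, hg⟩ := h D hD
    refine ⟨ball v, ?_, hg⟩
    obtain ⟨n, rfl⟩ := hξ
    refine Filter.mem_of_superset (Metric.ball_mem_nhds ξ (ε := (1 / 2 : ℝ) ^ n) (by positivity)) ?_
    exact fun η hη => mem_ball_iff_dist.2 hη
  · intro h
    choose U hU hg using h
    obtain ⟨δ, hδ, hL⟩ := lebesgue_number_lemma_of_metric (s := (Set.univ : Set (Boundary T)))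
      (c := fun ξ => interior (U ξ)) isCompact_univ (fun ξ => isOpen_interior)
      (fun ξ _ => Set.mem_iUnion.2 ⟨ξ, mem_interior_iff_mem_nhds.2 (hU ξ)⟩)
    obtain ⟨n, hn⟩ := exists_pow_lt_of_lt_one hδ (by norm_num : (1 / 2 : ℝ) < 1)
    refine ⟨Set.range fun ξ : Boundary T => ball (ξ.path n), ?_, ⟨?_, ?_⟩, ?_⟩
    · have := (finite_level (T := T) n).image (ball (T := T))
      rwa [← Set.range_comp] at this
    · rintro ⟨ξ, hξ⟩
      have : ξ ∈ ball (ξ.path n) := ⟨n, rfl⟩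
      simp only [hξ] at this
      exact this
    · intro ξ
      refine ⟨ball (ξ.path n), ⟨⟨ξ, rfl⟩, ⟨n, rfl⟩⟩, ?_⟩
      rintro _ ⟨⟨η, rfl⟩, hη⟩
      simp only [mem_ball_iff.1 hη]
    · rintro _ ⟨ξ, rfl⟩
      refine ⟨⟨_, rfl⟩, ?_⟩
      obtain ⟨i, hi⟩ := hL ξ trivial
      refine (hg i).mono fun η hη => interior_subset (hi ?_)
      exact (mem_ball_iff_dist.1 hη).trans hn

variable (T) in
/-- The group `AAut(T)` of almost automorphisms of `T`, acting on `∂T`. -/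
def AAut [T.LocallyFinite] : Subgroup (Boundary T ≃ₜ Boundary T) where
  carrier := {g | IsAlmostAutomorphism g}
  one_mem' := isAlmostAutomorphism_iff.2 fun ξ =>
    ⟨Set.univ, Filter.univ_mem, 1, one_pos, fun y _ z _ => (one_mul _).symm⟩
  mul_mem' := by
    intro g h hg hh
    refine isAlmostAutomorphism_iff.2 fun ξ => ?_
    obtain ⟨U, hU, c, hc, hcU⟩ := isAlmostAutomorphism_iff.1 hh ξ
    obtain ⟨W, hW, d, hd, hdW⟩ := isAlmostAutomorphism_iff.1 hg (h ξ)
    refine ⟨U ∩ h ⁻¹' W, Filter.inter_mem hU (h.continuous.continuousAt hW), d * c,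
      mul_pos hd hc, fun y hy z hz => ?_⟩
    rw [Homeomorph.mul_apply, Homeomorph.mul_apply, hdW _ hy.2 _ hz.2, hcU _ hy.1 _ hz.1, mul_assoc]
  inv_mem' := by
    intro g hg
    refine isAlmostAutomorphism_iff.2 fun ξ => ?_
    obtain ⟨U, hU, c, hc, hcU⟩ := isAlmostAutomorphism_iff.1 hg (g.symm ξ)
    refine ⟨g.symm ⁻¹' U, g.symm.continuous.continuousAt hU, c⁻¹, inv_pos.2 hc,
      fun y hy z hz => ?_⟩
    have := hcU _ hy _ hz
    rw [g.apply_symm_apply, g.apply_symm_apply] at this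
    rw [Homeomorph.inv_apply, Homeomorph.inv_apply, this, inv_mul_cancel_left₀ hc.ne']

end RootedTree

/-! The boundary is a compact ultrametric space and almost automorphisms are local homotheties of
it; the alternative holds for every group of local homotheties of such a space. By weak-*
compactness it suffices to treat a finitely generated group `H` without invariant probability
measure. All orbits of `H` are then infinite.

The dynamics of a single `g` is rigid (`IsLocalHomothety.exists_collapses`). Near a stable point,
orbits end in a ball that some power of `g` maps into itself, either contracting it to a periodic
point or acting isometrically. The unstable points lie in the finite attractor `R` of `g⁻¹`. Hence
suitable positive powers of `g` are nearly the identity on the closed set `K` swept out by the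
isometric balls, and push everything outside `K` and away from `R` to a finite set.

Consider all closed sets `K` on which powers of some `g ∈ H` collapse in this sense. If they had a
common point, their intersection would be a closed nonempty `H`-invariant set and would contain a
minimal set `M`. Either the scaling factors of `H` along `M` are bounded, so that `H` is
equicontinuous on `M` and preserves a measure, or some element of `H` contracts two points of `M`
towards each other (`IsMinimalSet.exists_contracting_of_not_preserves`). The first is excluded by
assumption, the second because powers of that element are nearly the identity on a `K` containing
`M`.

So the intersection is empty, and by compactness finitely many `K` already have no common point.
Products of collapsing elements collapse on the intersection (`Collapses.inter`), so `H` contains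
elements sending the complement of a neighbourhood of a finite set close to another finite set.
Neumann's lemma moves these finite sets apart, which yields a ping-pong pair. -/

/-! ### Groups of homeomorphisms as group actions -/

section HomeomorphAction

variable {X : Type*} [TopologicalSpace X]

/-- The tautological action of the homeomorphism group. -/
instance Homeomorph.tautologicalMulAction : MulAction (X ≃ₜ X) X where
  smul g x := g x
  one_smul _ := rfl
  mul_smul _ _ _ := rfl

/-- The ping-pong lemma also needs `V₁` and `V₂` nonempty. If one were empty, its partner `U` would
be the whole space, so the other two sets would be empty by disjointness; but then the other map
could send no point anywhere. -/
theorem IsPingPongPair.injective_lift [Nonempty X] {g h : X ≃ₜ X} (hgh : IsPingPongPair g h) :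
    Function.Injective (FreeGroup.lift ![g, h]) := by
  obtain ⟨U₁, U₂, V₁, V₂, -, hd, hg, hh⟩ := hgh
  simp only [List.pairwise_cons, List.mem_cons, List.not_mem_nil, or_false, forall_eq_or_imp,
    forall_eq, false_imp_iff, implies_true, List.Pairwise.nil, and_true] at hd
  obtain ⟨⟨hU, hUV, hUV'⟩, ⟨hVU, hVU'⟩, hV⟩ := hd
  have hne : ∀ {k : X ≃ₜ X} {U V U' V' : Set X}, k '' Uᶜ ⊆ V → Disjoint U U' → Disjoint U V' →
      ∀ {k' : X ≃ₜ X}, k' '' U'ᶜ ⊆ V' → V.Nonempty := by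
    intro k U V U' V' hk h1 h2 k' hk'
    by_contra hV
    rw [Set.not_nonempty_iff_eq_empty] at hV
    have hU : U = Set.univ := by
      refine Set.eq_univ_of_forall fun x => ?_
      by_contra hx
      have := hk ⟨x, hx, rfl⟩
      rw [hV] at this
      exact this
    subst hU
    obtain ⟨x⟩ := ‹Nonempty X›
    by_cases hx : x ∈ U'
    · exact h1.le_bot ⟨trivial, hx⟩
    · exact h2.le_bot ⟨trivial, hk' ⟨x, hx, rfl⟩⟩
  have hinv : ∀ {k : X ≃ₜ X} {U V : Set X}, k '' Uᶜ ⊆ V → (fun x => k⁻¹ x) '' Vᶜ ⊆ U := by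
    rintro k U V hk _ ⟨x, hx, rfl⟩
    by_contra hU
    exact hx (hk ⟨_, hU, by simp⟩)
  have hlift : Function.Injective (FreeGroup.lift fun i : ULift (Fin 2) => ![g, h] i.down) := by
    refine FreeGroup.injective_lift_of_ping_pong _ (fun i => ![V₁, V₂] i.down)
      (fun i => ![U₁, U₂] i.down) ?_ ?_ ?_ ?_ ?_ ?_
    · rintro ⟨i⟩
      fin_cases i
      · exact hne hg hU hUV' hh
      · exact hne hh hU.symm hVU hg
    · rintro ⟨i⟩ ⟨j⟩ hij
      fin_cases i <;> fin_cases j <;> simp_all [Function.onFun, disjoint_comm]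
    · rintro ⟨i⟩ ⟨j⟩ hij
      fin_cases i <;> fin_cases j <;> simp_all [Function.onFun, disjoint_comm]
    · rintro ⟨i⟩ ⟨j⟩
      fin_cases i <;> fin_cases j <;> simp_all [disjoint_comm]
    · rintro ⟨i⟩
      fin_cases i
      · exact hg
      · exact hh
    · rintro ⟨i⟩
      fin_cases i
      · exact hinv hg
      · exact hinv hh
  have hcomp : FreeGroup.lift ![g, h] =
      (FreeGroup.lift fun i : ULift (Fin 2) => ![g, h] i.down).comp
        (FreeGroup.map ULift.up) := by
    ext1 i
    simp
  rw [hcomp, MonoidHom.coe_comp]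
  exact hlift.comp (FreeGroup.map_injective ULift.up_injective)

end HomeomorphAction

/-- Neumann's separation lemma: if all orbits are infinite, then any finite set can be moved off any
other finite set. -/
theorem MulAction.exists_forall_smul_ne {G X : Type*} [Group G] [MulAction G X]
    {A B : Set X} (hA : A.Finite) (hB : B.Finite) (h : ∀ a ∈ A, (MulAction.orbit G a).Infinite) :
    ∃ g : G, ∀ a ∈ A, ∀ b ∈ B, g • a ≠ b := by
  classical
  by_contra! hcon
  choose f hf using fun p : {p : X × X // ∃ g : G, g • p.1 = p.2} => p.2
  let s : Finset {p : X × X // ∃ g : G, g • p.1 = p.2} :=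
    ((hA.prod hB).preimage Subtype.val_injective.injOn).toFinset
  -- If every `g` sends some `a ∈ A` into `B`, the group is covered by finitely many cosets of
  -- stabilizers. One stabilizer then has finite index, and the orbit of its point is finite.
  obtain ⟨k, hk, hfin⟩ := Subgroup.exists_finiteIndex_of_leftCoset_cover (s := s) (g := f)
    (H := fun p => MulAction.stabilizer G p.1.1) (by
      refine Set.eq_univ_of_forall fun g => ?_
      obtain ⟨a, ha, b, hb, hab⟩ := hcon g
      refine Set.mem_biUnion (x := ⟨(a, b), g, hab⟩) (by simp [s, ha, hb]) ?_
      rw [Set.mem_smul_set_iff_inv_smul_mem, SetLike.mem_coe, MulAction.mem_stabilizer_iff,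
        smul_eq_mul, mul_smul, inv_smul_eq_iff, hf, hab])
  refine h k.1.1 (by
    simp only [s, Set.Finite.mem_toFinset, Set.mem_preimage, Set.mem_prod] at hk
    exact hk.1) ?_
  refine Set.finite_of_ncard_ne_zero ?_
  rw [← MulAction.index_stabilizer]
  exact hfin.index_ne_zero

/-- Neumann's separation lemma for a group of homeomorphisms. -/
theorem Subgroup.exists_mem_forall_apply_ne {X : Type*} [TopologicalSpace X]
    {H : Subgroup (X ≃ₜ X)} {A B : Set X} (hA : A.Finite) (hB : B.Finite)
    (h : ∀ x : X, ((fun g : X ≃ₜ X => g x) '' (H : Set (X ≃ₜ X))).Infinite) :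
    ∃ g ∈ H, ∀ a ∈ A, ∀ b ∈ B, g a ≠ b := by
  obtain ⟨g, hg⟩ := MulAction.exists_forall_smul_ne (G := H) hA hB fun a _ => by
    refine (h a).mono ?_
    rintro _ ⟨g, hg, rfl⟩
    exact ⟨⟨g, hg⟩, rfl⟩
  exact ⟨g, g.2, hg⟩

/-! ### Ends exist and form an ultrametric space -/

namespace RootedTree

variable {T : RootedTree}

instance : IsStronglyAtomic T where
  exists_covBy_le_of_lt a b hab := by
    obtain ⟨n, hn⟩ := hab.le.exists_pred_iterate
    induction n generalizing b with
    | zero => exact absurd hn hab.ne'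
    | succ n ih =>
      rw [Function.iterate_succ_apply] at hn
      by_cases h : a = Order.pred b
      · exact ⟨b, h ▸ Order.pred_covBy_of_not_isMin (fun hb => hab.not_ge (hb hab.le)), le_rfl⟩
      · obtain ⟨x, hx, hxb⟩ := ih (Order.pred b) (lt_of_le_of_ne (Order.le_pred_of_lt hab) h) hn
        exact ⟨x, hx, hxb.trans (Order.pred_le b)⟩

/-- This is König's lemma. -/
instance [T.LocallyFinite] [Infinite T] : Nonempty (Boundary T) := by
  obtain ⟨f, h0, hf⟩ := exists_orderEmbedding_covby_of_forall_covby_finite_of_bot (α := T)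
    LocallyFinite.finite_children
  exact ⟨⟨f, h0, hf⟩⟩

instance : IsUltrametricDist (Boundary T) where
  dist_triangle_max ξ η ζ := PiNat.dist_triangle_nonarch ξ.path η.path ζ.path

end RootedTree

/-- Distinct points of a finite set are uniformly separated. -/
theorem Set.Finite.exists_pos_eq_of_dist_lt {X : Type*} [MetricSpace X] {s : Set X}
    (hs : s.Finite) : ∃ η > 0, ∀ u ∈ s, ∀ v ∈ s, dist u v < η → u = v := by
  by_cases hn : s.Nontrivial
  · refine ⟨_, hs.infsep_pos_iff_nontrivial.2 hn, fun u hu v hv huv => ?_⟩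
    by_contra hne
    exact huv.not_ge (Set.infsep_le_dist_of_mem hu hv hne)
  · exact ⟨1, one_pos, fun u hu v hv _ => Set.not_nontrivial_iff.1 hn hu hv⟩

/-! ### Invariant measures -/

section InvariantMeasure

variable {X : Type*} [MetricSpace X] [CompactSpace X] [MeasurableSpace X] [BorelSpace X]

/-- Probability measures on a compact space are weak-* compact, so an ultrafilter limit of
asymptotically invariant measures exists and is invariant. -/
theorem preservesRegularProbability_of_tendsto {ι : Type*} (l : Filter ι) [l.NeBot]
    (μ : ι → ProbabilityMeasure X) {H : Subgroup (X ≃ₜ X)}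
    (h : ∀ g ∈ H, ∀ f : BoundedContinuousFunction X ℝ,
      Filter.Tendsto (fun i => ∫ x, f (g x) ∂(μ i : Measure X) - ∫ x, f x ∂(μ i : Measure X))
        l (𝓝 0)) :
    PreservesRegularProbability H := by
  let U : Ultrafilter ι := Ultrafilter.of l
  obtain ⟨ν, hν⟩ : ∃ ν, Filter.Tendsto μ U (𝓝 ν) := by
    obtain ⟨ν, -, hν⟩ := isCompact_univ.ultrafilter_le_nhds (U.map μ) (by simp)
    exact ⟨ν, hν⟩
  refine ⟨ν, inferInstance, inferInstance, fun g hg => ?_⟩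
  have : IsProbabilityMeasure ((ν : Measure X).map g) :=
    Measure.isProbabilityMeasure_map g.continuous.measurable.aemeasurable
  refine ext_of_forall_integral_eq_of_IsFiniteMeasure fun f => ?_
  rw [integral_map g.continuous.measurable.aemeasurable f.continuous.aestronglyMeasurable]
  rw [ProbabilityMeasure.tendsto_iff_forall_integral_tendsto] at hν
  have h1 := hν (f.compContinuous ⟨g, g.continuous⟩)
  have h3 := (h g hg f).mono_left (Ultrafilter.of_le l)
  exact sub_eq_zero.1 (tendsto_nhds_unique (h1.sub (hν f)) h3)

/-- Along the directed set of finite subsets of `H`, each `g ∈ H` eventually preserves the chosen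
measures exactly. -/
theorem preservesRegularProbability_of_closure_finset {H : Subgroup (X ≃ₜ X)}
    (h : ∀ F : Finset (X ≃ₜ X), (F : Set (X ≃ₜ X)) ⊆ H →
      PreservesRegularProbability (Subgroup.closure (F : Set (X ≃ₜ X)))) :
    PreservesRegularProbability H := by
  classical
  choose μ hμ _ hinv using fun F : Finset H => h (F.map (Function.Embedding.subtype _))
    (by intro x hx; simp at hx; exact hx.1)
  refine preservesRegularProbability_of_tendsto Filter.atTop (fun F => ⟨μ F, hμ F⟩) ?_
  intro g hg f
  refine tendsto_const_nhds.congr' ?_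
  filter_upwards [Filter.eventually_ge_atTop ({⟨g, hg⟩} : Finset H)] with F hF
  have hgF : g ∈ Subgroup.closure ((F.map (Function.Embedding.subtype _) : Finset (X ≃ₜ X)) :
      Set (X ≃ₜ X)) := Subgroup.subset_closure (by
    simpa [hg] using hF)
  have := integral_map (μ := μ F) g.continuous.measurable.aemeasurable
    (f := f) f.continuous.aestronglyMeasurable
  rw [hinv F g hgF] at this
  exact (sub_eq_zero.2 this.symm).symm

/-- A group of homeomorphisms of a compact ultrametric space that acts equicontinuously on a
nonempty closed invariant set preserves a probability measure. -/
theorem preservesRegularProbability_of_equicontinuousOn [IsUltrametricDist X]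
    {H : Subgroup (X ≃ₜ X)} {M : Set X} (hMc : IsClosed M) (hM : M.Nonempty)
    (hinv : ∀ g ∈ H, Set.MapsTo g M M)
    (heq : ∀ ε > 0, ∃ η > 0, ∀ g ∈ H, ∀ x ∈ M, ∀ y ∈ M, dist x y < η → dist (g x) (g y) < ε) :
    PreservesRegularProbability H := by
  classical
  -- Transitivity is the ultrametric inequality. Equicontinuity makes the classes finite in number,
  -- and `H` permutes them; the measures averaging over one representative per class are invariant
  -- up to errors that vanish with `ε`.
  let S : ∀ ε : ℝ, 0 < ε → Setoid M := fun ε hε =>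
    { r := fun x y => ∀ g ∈ H, dist (g x) (g y) < ε
      iseqv :=
        { refl := fun x g _ => by simpa using hε
          symm := fun h g hg => by rw [dist_comm]; exact h g hg
          trans := fun h h' g hg =>
            (dist_triangle_max _ _ _).trans_lt (max_lt (h g hg) (h' g hg)) } }
  have hfin : ∀ ε hε, Finite (Quotient (S ε hε)) := by
    intro ε hε
    obtain ⟨η, hη, h⟩ := heq ε hε
    obtain ⟨t, htM, ht, hcov⟩ := hMc.isCompact.finite_cover_balls hη
    have : Finite t := ht
    refine Finite.of_surjective (fun x : t => (Quotient.mk (S ε hε) ⟨x, htM x.2⟩)) ?_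
    refine Quotient.ind fun y => ?_
    obtain ⟨x, hx, hy⟩ := Set.mem_iUnion₂.1 (hcov y.2)
    refine ⟨⟨x, hx⟩, Quotient.sound fun g hg => h g hg _ (htM hx) _ y.2 ?_⟩
    rw [dist_comm]; exact hy
  have hne : ∀ ε hε, Nonempty (Quotient (S ε hε)) := fun ε hε => ⟨Quotient.mk _ ⟨_, hM.some_mem⟩⟩
  let E : ℕ → ℝ := fun n => 1 / ((n : ℝ) + 1)
  have hE : ∀ n, 0 < E n := fun n => Nat.one_div_pos_of_nat
  let Q : ℕ → Type _ := fun n => Quotient (S (E n) (hE n))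
  let _ : ∀ n, Fintype (Q n) := fun n => @Fintype.ofFinite _ (hfin (E n) (hE n))
  have _ : ∀ n, Nonempty (Q n) := fun n => hne (E n) (hE n)
  let _ : ∀ n, MeasurableSpace (Q n) := fun n => ⊤
  let rep : ∀ n, Q n → X := fun n q => (Quotient.out q : M)
  let ν : ∀ n, Measure (Q n) := fun n => (PMF.uniformOfFintype (Q n)).toMeasure
  have hrep : ∀ n, Measurable (rep n) := fun n => measurable_from_top
  let μ : ℕ → ProbabilityMeasure X := fun n => ⟨(ν n).map (rep n),
    Measure.isProbabilityMeasure_map (hrep n).aemeasurable⟩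
  have hint : ∀ n (f : X → ℝ), Continuous f → ∫ x, f x ∂(μ n : Measure X) =
      ((Fintype.card (Q n) : ℝ))⁻¹ * ∑ q, f (rep n q) := by
    intro n f hf
    change ∫ x, f x ∂((ν n).map (rep n)) = _
    rw [integral_map (hrep n).aemeasurable hf.aestronglyMeasurable, PMF.integral_eq_sum,
      Finset.mul_sum]
    simp [PMF.uniformOfFintype_apply]
  refine preservesRegularProbability_of_tendsto Filter.atTop μ fun g hg f => ?_
  rw [Metric.tendsto_atTop]
  intro ε hε
  obtain ⟨η, hη, hf⟩ := Metric.uniformContinuous_iff.1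
    (CompactSpace.uniformContinuous_of_continuous f.continuous) (ε / 2) (half_pos hε)
  obtain ⟨N, hN⟩ := exists_nat_one_div_lt hη
  refine ⟨N, fun n hn => ?_⟩
  have hEn : E n < η := (Nat.one_div_le_one_div hn).trans_lt hN
  let σ : Q n → Q n := Quotient.map' (fun x : M => (⟨g x, hinv g hg x.2⟩ : M))
    fun x y hxy k hk => hxy (k * g) (H.mul_mem hk hg)
  have hσ : Function.Injective σ := by
    intro p q
    induction p using Quotient.ind with | _ x
    induction q using Quotient.ind with | _ y
    intro h
    refine Quotient.sound fun k hk => ?_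
    have := (Quotient.exact h) (k * g⁻¹) (H.mul_mem hk (H.inv_mem hg))
    simpa using this
  have hclose : ∀ q, dist (g (rep n q)) (rep n (σ q)) < E n := by
    intro q
    have : Quotient.mk (S (E n) (hE n)) ⟨g (rep n q), hinv g hg (Quotient.out q).2⟩ =
        Quotient.mk _ (Quotient.out (σ q)) := by
      conv_rhs => rw [Quotient.out_eq, ← Quotient.out_eq q]
      rfl
    exact Quotient.exact this 1 H.one_mem
  have hperm : ∑ q, f (rep n (σ q)) = ∑ q, f (rep n q) :=
    (Equiv.ofBijective σ (Finite.injective_iff_bijective.1 hσ)).sum_comp fun q => f (rep n q)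
  rw [hint n (fun x => f (g x)) (f.continuous.comp g.continuous), hint n f f.continuous, ← hperm,
    ← mul_sub, ← Finset.sum_sub_distrib, dist_zero_right, norm_mul]
  have hcard : (0 : ℝ) < Fintype.card (Q n) := by exact_mod_cast Fintype.card_pos
  have hsum : ‖∑ q, (f (g (rep n q)) - f (rep n (σ q)))‖ ≤ Fintype.card (Q n) * (ε / 2) := by
    refine (norm_sum_le _ _).trans ?_
    refine (Finset.sum_le_card_nsmul _ _ (ε / 2) fun q _ => ?_).trans (by simp)
    rw [← dist_eq_norm]
    exact (hf ((hclose q).trans hEn)).le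
  rw [norm_inv, Real.norm_of_nonneg hcard.le]
  calc _ ≤ (Fintype.card (Q n) : ℝ)⁻¹ * (Fintype.card (Q n) * (ε / 2)) := by gcongr
    _ = ε / 2 := by field_simp
    _ < ε := half_lt_self hε

/-- A group of homeomorphisms without invariant probability measure has infinite orbits. -/
theorem infinite_orbit_of_not_preservesRegularProbability [IsUltrametricDist X]
    {H : Subgroup (X ≃ₜ X)} (hH : ¬ PreservesRegularProbability H) (x : X) :
    ((fun g : X ≃ₜ X => g x) '' (H : Set (X ≃ₜ X))).Infinite := by
  intro hfin
  -- On a finite orbit equicontinuity is trivial: sufficiently close points coincide.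
  refine hH (preservesRegularProbability_of_equicontinuousOn hfin.isClosed
    ⟨x, 1, H.one_mem, rfl⟩ ?_ ?_)
  · rintro g hg _ ⟨k, hk, rfl⟩
    exact ⟨g * k, H.mul_mem hg hk, rfl⟩
  · intro ε hε
    obtain ⟨η, hη, h⟩ := hfin.exists_pos_eq_of_dist_lt
    refine ⟨η, hη, fun g _ u hu v hv huv => ?_⟩
    rw [h u hu v hv huv, dist_self]
    exact hε

end InvariantMeasure

/-! ### Collapsing homeomorphisms -/

section Collapse

variable {X : Type*} [MetricSpace X]

/-- Up to `ε`, the map `h` is the identity on `K` and sends the points outside `K` that are not too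
close to `R` (or belong to `R`) into `Φ`. -/
def IsCollapsing (R Φ K : Set X) (ε : ℝ) (h : X → X) : Prop :=
  (∀ x ∉ K, (∀ r ∈ R, x = r ∨ ε ≤ dist x r) → ∃ φ ∈ Φ, dist (h x) φ < ε) ∧
    ∀ x ∈ K, dist (h x) x < ε

/-- The set `A` contains, for suitable finite sets `R` and `Φ` and every `ε`, a homeomorphism
that is nearly the identity on `K` and collapses the rest of the space to `Φ`, away from `R`. -/
def Collapses (A : Set (X ≃ₜ X)) (K : Set X) : Prop :=
  ∃ R Φ : Set X, R.Finite ∧ Φ.Finite ∧ ∀ ε > 0, ∃ h ∈ A, IsCollapsing R Φ K ε h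

/-- The powers of `g` with positive exponent. -/
def positivePowers (g : X ≃ₜ X) : Set (X ≃ₜ X) := {h | ∃ n : ℕ, 1 ≤ n ∧ h = g ^ n}

theorem IsCollapsing.mono {R Φ K : Set X} {ε ε' : ℝ} {h : X → X} (hh : IsCollapsing R Φ K ε h)
    (hε : ε ≤ ε') : IsCollapsing R Φ K ε' h := by
  refine ⟨fun x hx hr => ?_, fun x hx => (hh.2 x hx).trans_le hε⟩
  obtain ⟨φ, hφ, h'⟩ := hh.1 x hx fun r hr' => (hr r hr').imp_right hε.trans
  exact ⟨φ, hφ, h'.trans_le hε⟩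

theorem Collapses.mono {A B : Set (X ≃ₜ X)} {K : Set X} (h : Collapses A K) (hAB : A ⊆ B) :
    Collapses B K := by
  obtain ⟨R, Φ, hR, hΦ, h⟩ := h
  refine ⟨R, Φ, hR, hΦ, fun ε hε => ?_⟩
  obtain ⟨k, hk, hc⟩ := h ε hε
  exact ⟨k, hAB hk, hc⟩

theorem collapses_univ (H : Subgroup (X ≃ₜ X)) : Collapses (H : Set (X ≃ₜ X)) Set.univ :=
  ⟨∅, ∅, Set.finite_empty, Set.finite_empty, fun ε hε => ⟨1, H.one_mem,
    fun x hx => absurd (Set.mem_univ x) hx, fun x _ => by simpa using hε⟩⟩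

variable [CompactSpace X]

theorem Homeomorph.exists_dist_apply_lt (g : X ≃ₜ X) {ε : ℝ} (hε : 0 < ε) :
    ∃ η > 0, η ≤ ε ∧ ∀ x y, dist x y < η → dist (g x) (g y) < ε := by
  obtain ⟨η, hη, h⟩ := Metric.uniformContinuous_iff.1
    (CompactSpace.uniformContinuous_of_continuous g.continuous) ε hε
  exact ⟨min η ε, lt_min hη hε, min_le_right _ _,
    fun x y hxy => h (hxy.trans_le (min_le_left _ _))⟩

/-- Apply `g₁` first, so precisely that `g₂` does not spoil the estimate. Points of `K₁` outside
`K₂` hardly move and are then collapsed by `g₂`. Points outside `K₁` land near some `φ ∈ Φ₁`, which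
`g₂` nearly fixes or collapses. For this `φ` must not be close to `R₂` without belonging to it,
which holds for small `ε`; the case `φ ∈ R₂` is why `IsCollapsing` also controls the points of `R`.
-/
theorem Collapses.inter [IsUltrametricDist X] {H : Subgroup (X ≃ₜ X)} {K₁ K₂ : Set X}
    (h₁ : Collapses (H : Set (X ≃ₜ X)) K₁) (h₂ : Collapses (H : Set (X ≃ₜ X)) K₂) :
    Collapses (H : Set (X ≃ₜ X)) (K₁ ∩ K₂) := by
  obtain ⟨R₁, Φ₁, hR₁, hΦ₁, h₁⟩ := h₁
  obtain ⟨R₂, Φ₂, hR₂, hΦ₂, h₂⟩ := h₂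
  obtain ⟨ε₀, hε₀, hsep⟩ := (hΦ₁.union hR₂).exists_pos_eq_of_dist_lt
  refine ⟨R₁ ∪ R₂, Φ₁ ∪ Φ₂, hR₁.union hR₂, hΦ₁.union hΦ₂, fun ε' hε' => ?_⟩
  obtain ⟨ε, hε, hεε', hεε₀⟩ : ∃ ε > 0, ε ≤ ε' ∧ ε ≤ ε₀ :=
    ⟨min ε' ε₀, lt_min hε' hε₀, min_le_left _ _, min_le_right _ _⟩
  obtain ⟨g₂, hg₂, hc₂⟩ := h₂ ε hε
  obtain ⟨η, hη, hηε, hg₂η⟩ := g₂.exists_dist_apply_lt hε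
  obtain ⟨g₁, hg₁, hc₁⟩ := h₁ η hη
  have tri : ∀ {a b c : X}, dist a b < ε → dist b c < ε → dist a c < ε := fun h h' =>
    (dist_triangle_max _ _ _).trans_lt (max_lt h h')
  refine ⟨g₂ * g₁, H.mul_mem hg₂ hg₁, IsCollapsing.mono ⟨fun x hx hr => ?_, fun x hx => ?_⟩ hεε'⟩
  · by_cases hx₁ : x ∈ K₁
    · have hx₂ : x ∉ K₂ := fun h => hx ⟨hx₁, h⟩
      obtain ⟨φ, hφ, h⟩ := hc₂.1 x hx₂ fun r hr' => hr r (Or.inr hr')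
      exact ⟨φ, Or.inr hφ, tri (hg₂η _ _ (hc₁.2 x hx₁)) h⟩
    · obtain ⟨φ, hφ, h⟩ := hc₁.1 x hx₁ fun r hr' => (hr r (Or.inl hr')).imp_right hηε.trans
      have h' := hg₂η _ _ h
      by_cases hφ₂ : φ ∈ K₂
      · exact ⟨φ, Or.inl hφ, tri h' (hc₂.2 φ hφ₂)⟩
      · obtain ⟨ψ, hψ, h''⟩ := hc₂.1 φ hφ₂ fun r hr' => by
          by_cases hd : dist φ r < ε
          · exact Or.inl (hsep φ (Or.inl hφ) r (Or.inr hr') (hd.trans_le hεε₀))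
          · exact Or.inr (not_lt.1 hd)
        exact ⟨ψ, Or.inr hψ, tri h' h''⟩
  · exact tri (hg₂η _ _ (hc₁.2 x hx.1)) (hc₂.2 x hx.2)

/-- This makes the intersection of all collapsing sets of a group invariant. -/
theorem Collapses.conj {g : X ≃ₜ X} {K : Set X} (h : Collapses (positivePowers g) K)
    (k : X ≃ₜ X) : Collapses (positivePowers (k * g * k⁻¹)) (k '' K) := by
  obtain ⟨R, Φ, hR, hΦ, h⟩ := h
  refine ⟨k '' R, k '' Φ, hR.image k, hΦ.image k, fun ε hε => ?_⟩
  obtain ⟨η, hη, -, hk⟩ := k.exists_dist_apply_lt hε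
  obtain ⟨_, ⟨n, hn, rfl⟩, hc⟩ := h η hη
  refine ⟨_, ⟨n, hn, rfl⟩, ?_, ?_⟩
  · intro x hx hr
    obtain ⟨y, rfl⟩ := k.surjective x
    obtain ⟨φ, hφ, h'⟩ := hc.1 y (fun hy => hx ⟨y, hy, rfl⟩) fun r hr' => by
      refine (hr _ ⟨r, hr', rfl⟩).imp (fun h => k.injective h) fun h => ?_
      by_contra! hlt
      exact (hk _ _ hlt).not_ge h
    refine ⟨k φ, ⟨φ, hφ, rfl⟩, ?_⟩
    rw [conj_pow]
    simpa using hk _ _ h'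
  · rintro _ ⟨y, hy, rfl⟩
    rw [conj_pow]
    simpa using hk _ _ (hc.2 y hy)

/-- A collapsing group with infinite orbits contains a ping-pong pair. -/
theorem Collapses.exists_isPingPongPair {H : Subgroup (X ≃ₜ X)}
    (h : Collapses (H : Set (X ≃ₜ X)) ∅)
    (hH : ∀ x : X, ((fun g : X ≃ₜ X => g x) '' (H : Set (X ≃ₜ X))).Infinite) :
    ∃ g ∈ H, ∃ h ∈ H, IsPingPongPair g h := by
  obtain ⟨R, Φ, hR, hΦ, h⟩ := h
  -- Composing with `k` makes the attractor `Ψ` disjoint from the repeller `R`; conjugating by `l`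
  -- below gives a second map whose attractor and repeller avoid both.
  obtain ⟨k, hk, hkR⟩ := Subgroup.exists_mem_forall_apply_ne hΦ hR hH
  set Ψ := k '' Φ with hΨdef
  have hΨ : Ψ.Finite := hΦ.image k
  have hRΨ : Disjoint R Ψ := by
    rw [Set.disjoint_right]
    rintro _ ⟨φ, hφ, rfl⟩ h'
    exact hkR φ hφ _ h' rfl
  obtain ⟨l, hl, hlR⟩ := Subgroup.exists_mem_forall_apply_ne (hR.union hΨ) (hR.union hΨ) hH
  have hlne : ∀ {A B : Set X}, A ⊆ R ∪ Ψ → B ⊆ R ∪ Ψ → Disjoint A (l '' B) := by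
    intro A B hA hB
    rw [Set.disjoint_right]
    rintro _ ⟨b, hb, rfl⟩ ha
    exact hlR b (hB hb) _ (hA ha) rfl
  obtain ⟨η, hη, hsep⟩ :=
    ((hR.union hΨ).union ((hR.union hΨ).image l)).exists_pos_eq_of_dist_lt
  have hdisj : ∀ {A B : Set X}, Disjoint A B → A ⊆ (R ∪ Ψ) ∪ l '' (R ∪ Ψ) →
      B ⊆ (R ∪ Ψ) ∪ l '' (R ∪ Ψ) →
      Disjoint (Metric.thickening (η / 2) A) (Metric.thickening (η / 2) B) := by
    intro A B hAB hA hB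
    rw [Set.disjoint_left]
    intro x hxA hxB
    obtain ⟨a, ha, hxa⟩ := Metric.mem_thickening_iff.1 hxA
    obtain ⟨b, hb, hxb⟩ := Metric.mem_thickening_iff.1 hxB
    have : a = b := hsep a (hA ha) b (hB hb) (by
      have := dist_triangle_left a b x
      linarith)
    exact hAB.le_bot ⟨ha, this ▸ hb⟩
  -- The tolerances are chosen backwards: thickenings by `η / 2` are disjoint, `l` maps
  -- `ε`-thickenings into them, and `k` turns an error `ε'` into at most `ε`.
  obtain ⟨ε, hε, hεη, hlε⟩ := l.exists_dist_apply_lt (half_pos hη)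
  obtain ⟨ε', hε', hε'ε, hkε'⟩ := k.exists_dist_apply_lt hε
  obtain ⟨g, hg, hc⟩ := h ε' hε'
  have hthick : ∀ A : Set X, l '' Metric.thickening ε A ⊆ Metric.thickening (η / 2) (l '' A) := by
    rintro A _ ⟨x, hx, rfl⟩
    obtain ⟨a, ha, hxa⟩ := Metric.mem_thickening_iff.1 hx
    exact Metric.mem_thickening_iff.2 ⟨l a, ⟨a, ha, rfl⟩, hlε _ _ hxa⟩
  have hmono : ∀ A : Set X, Metric.thickening ε A ⊆ Metric.thickening (η / 2) A :=
    fun A => Metric.thickening_mono hεη A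
  have hkg : (k * g) '' (Metric.thickening ε R)ᶜ ⊆ Metric.thickening ε Ψ := by
    rintro _ ⟨x, hx, rfl⟩
    obtain ⟨φ, hφ, hxφ⟩ := hc.1 x (Set.notMem_empty x) fun r hr => by
      refine Or.inr (hε'ε.trans ?_)
      by_contra! hlt
      exact hx (Metric.mem_thickening_iff.2 ⟨r, hr, hlt⟩)
    exact Metric.mem_thickening_iff.2 ⟨k φ, ⟨φ, hφ, rfl⟩, hkε' _ _ hxφ⟩
  have hRs : R ⊆ R ∪ Ψ := Set.subset_union_left
  have hΨs : Ψ ⊆ R ∪ Ψ := Set.subset_union_right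
  refine ⟨k * g, H.mul_mem hk hg, l * (k * g) * l⁻¹,
    H.mul_mem (H.mul_mem hl (H.mul_mem hk hg)) (H.inv_mem hl), Metric.thickening ε R,
    l '' Metric.thickening ε R, Metric.thickening ε Ψ, l '' Metric.thickening ε Ψ,
    ⟨Metric.isOpen_thickening, l.isOpen_image.2 Metric.isOpen_thickening,
      Metric.isOpen_thickening, l.isOpen_image.2 Metric.isOpen_thickening⟩, ?_, hkg, ?_⟩
  · have hS : ∀ {A : Set X}, A ⊆ R ∪ Ψ → A ⊆ (R ∪ Ψ) ∪ l '' (R ∪ Ψ) := fun h =>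
      h.trans Set.subset_union_left
    have hS' : ∀ {A : Set X}, A ⊆ R ∪ Ψ → l '' A ⊆ (R ∪ Ψ) ∪ l '' (R ∪ Ψ) := fun h =>
      (Set.image_mono h).trans Set.subset_union_right
    simp only [List.pairwise_cons, List.mem_cons, List.not_mem_nil, or_false, forall_eq_or_imp,
      forall_eq, false_imp_iff, implies_true, List.Pairwise.nil, and_true]
    refine ⟨⟨?_, ?_, ?_⟩, ⟨?_, ?_⟩, ?_⟩
    · exact (hdisj (hlne hRs hRs) (hS hRs) (hS' hRs)).mono (hmono _) (hthick _)
    · exact (hdisj hRΨ (hS hRs) (hS hΨs)).mono (hmono _) (hmono _)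
    · exact (hdisj (hlne hRs hΨs) (hS hRs) (hS' hΨs)).mono (hmono _) (hthick _)
    · exact ((hdisj (hlne hΨs hRs) (hS hΨs) (hS' hRs)).mono (hmono _) (hthick _)).symm
    · exact (Set.disjoint_image_iff l.injective).2
        ((hdisj hRΨ (hS hRs) (hS hΨs)).mono (hmono _) (hmono _))
    · exact (hdisj (hlne hΨs hΨs) (hS hΨs) (hS' hΨs)).mono (hmono _) (hthick _)
  · rintro _ ⟨x, hx, rfl⟩
    obtain ⟨y, rfl⟩ := l.surjective x
    refine ⟨(k * g) y, hkg ⟨y, fun hy => hx ⟨y, hy, rfl⟩, rfl⟩, by simp⟩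

end Collapse

/-! ### Local homotheties -/

section LocalHomothety

variable {X : Type*} [MetricSpace X]

/-- `g` multiplies distances by `c` on the open ball of radius `r` around `x`. -/
def HomothetyAt (g : X → X) (x : X) (r c : ℝ) : Prop :=
  0 < c ∧ ∀ u v, dist u x < r → dist v x < r → dist (g u) (g v) = c * dist u v

/-- `g` is a homothety near every point. -/
def IsLocalHomothety (g : X → X) : Prop :=
  ∀ x, ∃ r > 0, ∃ c, HomothetyAt g x r c

theorem HomothetyAt.mono {g : X → X} {x : X} {r r' c : ℝ} (h : HomothetyAt g x r c)
    (hr : r' ≤ r) : HomothetyAt g x r' c :=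
  ⟨h.1, fun u v hu hv => h.2 u v (hu.trans_le hr) (hv.trans_le hr)⟩

theorem HomothetyAt.dist_lt {g : X → X} {x u : X} {r c : ℝ} (h : HomothetyAt g x r c)
    (hu : dist u x < r) : dist (g u) (g x) < c * r := by
  rw [h.2 u x hu (by simpa using dist_nonneg.trans_lt hu)]
  exact mul_lt_mul_of_pos_left hu h.1

theorem HomothetyAt.comp {g h : X → X} {x : X} {r r' c c' : ℝ} (hh : HomothetyAt h (g x) r' c')
    (hg : HomothetyAt g x r c) (hr : c * r ≤ r') : HomothetyAt (fun y => h (g y)) x r (c' * c) := by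
  refine ⟨mul_pos hh.1 hg.1, fun u v hu hv => ?_⟩
  rw [hh.2 _ _ ((hg.dist_lt hu).trans_le hr) ((hg.dist_lt hv).trans_le hr), hg.2 u v hu hv,
    mul_assoc]

theorem HomothetyAt.eq {g : X → X} {x : X} {r r' c c' : ℝ} (h : HomothetyAt g x r c)
    (h' : HomothetyAt g x r' c') (hr : 0 < r) (hr' : 0 < r')
    (hx : ∀ ε > 0, ∃ y, y ≠ x ∧ dist y x < ε) : c = c' := by
  obtain ⟨y, hne, hy⟩ := hx (min r r') (lt_min hr hr')
  have h1 := h.2 y x (hy.trans_le (min_le_left _ _)) (by simpa)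
  rw [h'.2 y x (hy.trans_le (min_le_right _ _)) (by simpa)] at h1
  exact (mul_right_cancel₀ (dist_ne_zero.2 hne) h1).symm

theorem homothetyAt_id (x : X) (r : ℝ) : HomothetyAt (fun y : X => y) x r 1 :=
  ⟨one_pos, fun _ _ _ _ => (one_mul _).symm⟩

theorem IsLocalHomothety.exists_uniform [CompactSpace X] {g : X → X} (hg : IsLocalHomothety g) :
    ∃ δ > 0, ∀ x, ∃ c, HomothetyAt g x δ c := by
  choose r hr c hc using hg
  obtain ⟨δ, hδ, h⟩ := lebesgue_number_lemma_of_metric (s := (Set.univ : Set X))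
    (c := fun x => Metric.ball x (r x)) isCompact_univ (fun x => Metric.isOpen_ball)
    (fun x _ => Set.mem_iUnion.2 ⟨x, Metric.mem_ball_self (hr x)⟩)
  refine ⟨δ, hδ, fun x => ?_⟩
  obtain ⟨y, hy⟩ := h x trivial
  exact ⟨c y, (hc y).1, fun u v hu hv => (hc y).2 u v (hy hu) (hy hv)⟩

theorem exists_uniform_homothety [CompactSpace X] {A : Set (X ≃ₜ X)} (hA : A.Finite)
    (h : ∀ g ∈ A, IsLocalHomothety g) : ∃ δ > 0, ∀ g ∈ A, ∀ x, ∃ c, HomothetyAt g x δ c := by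
  induction A, hA using Set.Finite.induction_on with
  | empty => exact ⟨1, one_pos, fun g hg => absurd hg (Set.notMem_empty g)⟩
  | @insert g A _ _ ih =>
    obtain ⟨δ, hδ, h1⟩ := ih fun k hk => h k (Or.inr hk)
    obtain ⟨δ', hδ', h2⟩ := (h g (Or.inl rfl)).exists_uniform
    refine ⟨min δ δ', lt_min hδ hδ', ?_⟩
    rintro k (rfl | hk) x
    · obtain ⟨c, hc⟩ := h2 x
      exact ⟨c, hc.mono (min_le_right _ _)⟩
    · obtain ⟨c, hc⟩ := h1 k hk x
      exact ⟨c, hc.mono (min_le_left _ _)⟩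

end LocalHomothety

/-! ### Minimal sets of finitely generated groups of local homotheties -/

section MinimalSet

variable {X : Type*} [MetricSpace X] [CompactSpace X]

/-- All orbits of points of `M` are dense in the closed invariant set `M`. -/
structure IsMinimalSet (H : Subgroup (X ≃ₜ X)) (M : Set X) : Prop where
  isClosed : IsClosed M
  nonempty : M.Nonempty
  mapsTo : ∀ g ∈ H, Set.MapsTo g M M
  exists_dist_lt : ∀ x ∈ M, ∀ y ∈ M, ∀ ε > 0, ∃ g ∈ H, dist (g x) y < ε

theorem exists_isMinimalSet_subset {H : Subgroup (X ≃ₜ X)} {N : Set X} (hNc : IsClosed N)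
    (hN : N.Nonempty) (hinv : ∀ g ∈ H, Set.MapsTo g N N) : ∃ M ⊆ N, IsMinimalSet H M := by
  obtain ⟨M, hMN, hM⟩ := zorn_superset_nonempty
    {A : Set X | IsClosed A ∧ A.Nonempty ∧ ∀ g ∈ H, Set.MapsTo g A A} (by
      intro c hc hchain hne
      refine ⟨⋂₀ c, ⟨isClosed_sInter fun A hA => (hc hA).1, ?_, fun g hg x hx A hA =>
        (hc hA).2.2 g hg (hx A hA)⟩, fun A hA => Set.sInter_subset_of_mem hA⟩
      have : Nonempty c := hne.to_subtype
      rw [Set.sInter_eq_iInter]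
      refine IsCompact.nonempty_iInter_of_directed_nonempty_isCompact_isClosed _ ?_
        (fun A => (hc A.2).2.1) (fun A => (hc A.2).1.isCompact) (fun A => (hc A.2).1)
      intro A B
      rcases hchain.total A.2 B.2 with h | h
      · exact ⟨A, subset_rfl, h⟩
      · exact ⟨B, h, subset_rfl⟩) N ⟨hNc, hN, hinv⟩
  refine ⟨M, hMN, hM.prop.1, hM.prop.2.1, hM.prop.2.2, fun x hx y hy ε hε => ?_⟩
  have hsub : closure ((fun g : X ≃ₜ X => g x) '' (H : Set (X ≃ₜ X))) ⊆ M := by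
    refine closure_minimal ?_ hM.prop.1
    rintro _ ⟨g, hg, rfl⟩
    exact hM.prop.2.2 g hg hx
  have heq := hM.eq_of_subset (t := closure ((fun g : X ≃ₜ X => g x) '' (H : Set (X ≃ₜ X))))
    ⟨isClosed_closure, ⟨x, subset_closure ⟨1, H.one_mem, rfl⟩⟩, fun g hg =>
      (show Set.MapsTo g _ _ by
        rintro _ ⟨k, hk, rfl⟩
        exact ⟨g * k, H.mul_mem hg hk, rfl⟩).closure g.continuous⟩ hsub
  rw [← heq] at hy
  obtain ⟨_, ⟨g, hg, rfl⟩, h⟩ := Metric.mem_closure_iff.1 hy ε hε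
  exact ⟨g, hg, by rwa [dist_comm]⟩

variable {H : Subgroup (X ≃ₜ X)} {M : Set X}

/-- An infinite orbit accumulates somewhere in `M`, and minimality carries the accumulation point
close to `x`. Absence of isolated points makes scaling factors on `M` well defined. -/
theorem IsMinimalSet.exists_ne_dist_lt (hM : IsMinimalSet H M)
    (hH : ∀ x : X, ((fun g : X ≃ₜ X => g x) '' (H : Set (X ≃ₜ X))).Infinite)
    {x : X} (hx : x ∈ M) {ε : ℝ} (hε : 0 < ε) : ∃ y ∈ M, y ≠ x ∧ dist y x < ε := by
  obtain ⟨z, hz, hacc⟩ := (hH x).exists_accPt_of_subset_isCompact hM.isClosed.isCompact (by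
    rintro _ ⟨g, hg, rfl⟩
    exact hM.mapsTo g hg hx)
  obtain ⟨g, hg, hgz⟩ := hM.exists_dist_lt z hz x hx ε hε
  have hev : ∀ᶠ w in 𝓝 z, dist (g w) x < ε :=
    (g.continuous.dist continuous_const).continuousAt.eventually (gt_mem_nhds hgz)
  obtain ⟨w, ⟨hw, k, hk, rfl⟩, hne⟩ := (accPt_iff_nhds.1 hacc) _ hev
  have hgw : g (k x) ∈ M := hM.mapsTo g hg (hM.mapsTo k hk hx)
  by_cases h : g z = x
  · exact ⟨g (k x), hgw, fun h' => hne (g.injective (h'.trans h.symm)), hw⟩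
  · exact ⟨g z, hM.mapsTo g hg hz, h, hgz⟩

/-- Since the radius `δ` is fixed, pass to limits `y n → a` and `g n (y n) → z`, and use minimality
to bring `z` back near `a` by some `k`. For large `n`, `k * g n` maps the `δ`-ball around `a` into
itself with ratio below 1, and this ball contains a second point of `M`. -/
theorem IsMinimalSet.exists_contracting (hM : IsMinimalSet H M)
    (hH : ∀ x : X, ((fun g : X ≃ₜ X => g x) '' (H : Set (X ≃ₜ X))).Infinite)
    (hloc : ∀ g ∈ H, IsLocalHomothety g) [IsUltrametricDist X] {δ : ℝ} (hδ : 0 < δ)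
    (h : ∀ c₀ > 0, ∃ g ∈ H, ∃ y ∈ M, ∃ c < c₀, HomothetyAt g y δ c) :
    ∃ g ∈ H, ∃ y ∈ M, ∃ y' ∈ M, y ≠ y' ∧ ∃ c < 1, 0 < c ∧
      ∀ n : ℕ, dist ((g ^ n) y) ((g ^ n) y') = c ^ n * dist y y' := by
  choose g hg y hy c hcn hc using fun n : ℕ => h (1 / ((n : ℝ) + 1)) Nat.one_div_pos_of_nat
  have hc0 : Filter.Tendsto c Filter.atTop (𝓝 0) :=
    squeeze_zero (fun n => (hc n).1.le) (fun n => (hcn n).le)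
      tendsto_one_div_add_atTop_nhds_zero_nat
  obtain ⟨⟨a, z⟩, ⟨ha, hz⟩, φ, hφ, hlim⟩ := (hM.isClosed.isCompact.prod
    hM.isClosed.isCompact).tendsto_subseq (x := fun n => (y n, g n (y n)))
    fun n => ⟨hy n, hM.mapsTo _ (hg n) (hy n)⟩
  have hlim1 : Filter.Tendsto (fun n => y (φ n)) Filter.atTop (𝓝 a) :=
    (continuous_fst.tendsto _).comp hlim
  have hlim2 : Filter.Tendsto (fun n => g (φ n) (y (φ n))) Filter.atTop (𝓝 z) :=
    (continuous_snd.tendsto _).comp hlim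
  have hlim3 : Filter.Tendsto (fun n => c (φ n)) Filter.atTop (𝓝 0) := hc0.comp hφ.tendsto_atTop
  obtain ⟨k, hk, hkz⟩ := hM.exists_dist_lt z hz a ha δ hδ
  obtain ⟨r, hr, κ, hκ⟩ := hloc k hk z
  obtain ⟨ρ, hρ, hρr, hkρ⟩ : ∃ ρ > 0, ρ ≤ r ∧ κ * ρ ≤ δ :=
    ⟨min r (δ / κ), lt_min hr (div_pos hδ hκ.1), min_le_left _ _, by
      calc κ * min r (δ / κ) ≤ κ * (δ / κ) := by gcongr; exacts [hκ.1.le, min_le_right _ _]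
        _ = δ := by field_simp [hκ.1.ne']⟩
  have e1 : ∀ᶠ n in Filter.atTop, dist (y (φ n)) a < δ :=
    hlim1.eventually (Metric.ball_mem_nhds a hδ)
  have e2 : ∀ᶠ n in Filter.atTop, dist (g (φ n) (y (φ n))) z < ρ :=
    hlim2.eventually (Metric.ball_mem_nhds z hρ)
  have e3 : ∀ᶠ n in Filter.atTop, c (φ n) * δ < ρ := by
    have := hlim3.mul_const δ
    rw [zero_mul] at this
    exact this.eventually (gt_mem_nhds hρ)
  have e4 : ∀ᶠ n in Filter.atTop, κ * c (φ n) < 1 := by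
    have := hlim3.const_mul κ
    rw [mul_zero] at this
    exact this.eventually (gt_mem_nhds one_pos)
  obtain ⟨n, h1, h2, h3, h4⟩ := (e1.and (e2.and (e3.and e4))).exists
  have tri : ∀ {a b c : X} {r : ℝ}, dist a b < r → dist b c < r → dist a c < r := fun h h' =>
    (dist_triangle_max _ _ _).trans_lt (max_lt h h')
  have hga : ∀ u, dist u a < δ → dist (g (φ n) u) z < ρ := fun u hu =>
    tri (((hc (φ n)).dist_lt (tri hu (by rwa [dist_comm]))).trans h3) h2
  set f := k * g (φ n) with hf
  have hfa : ∀ u, dist u a < δ → dist (f u) a < δ := fun u hu =>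
    tri (((hκ.mono hρr).dist_lt (hga u hu)).trans_le hkρ) hkz
  have hfd : ∀ u v, dist u a < δ → dist v a < δ → dist (f u) (f v) = κ * c (φ n) * dist u v := by
    intro u v hu hv
    have hay : dist a (y (φ n)) < δ := by rwa [dist_comm]
    change dist (k (g (φ n) u)) (k (g (φ n) v)) = _
    rw [(hκ.mono hρr).2 _ _ (hga u hu) (hga v hv), (hc (φ n)).2 u v (tri hu hay) (tri hv hay),
      mul_assoc]
  obtain ⟨a', ha', hne, hd⟩ := hM.exists_ne_dist_lt hH ha hδ
  refine ⟨f, H.mul_mem hk (hg _), a, ha, a', ha', hne.symm, _, h4, mul_pos hκ.1 (hc _).1, ?_⟩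
  have hpow : ∀ n : ℕ, dist ((f ^ n) a) a < δ ∧ dist ((f ^ n) a') a < δ := by
    intro n
    induction n with
    | zero => simpa [hδ] using hd
    | succ n ih =>
      rw [pow_succ']
      exact ⟨hfa _ ih.1, hfa _ ih.2⟩
  intro m
  induction m with
  | zero => simp
  | succ m ih =>
    rw [pow_succ' f, pow_succ' (κ * c (φ n)), mul_assoc (κ * c (φ n)), ← ih]
    exact hfd _ _ (hpow m).1 (hpow m).2

end MinimalSet

/-! ### Scaling factors of words and equicontinuity -/

section Derivative

variable {X : Type*} [MetricSpace X]

/-- The factor by which the local homothety `g` scales distances near `x`. -/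
noncomputable def scalingFactor (g : X ≃ₜ X) (x : X) : ℝ :=
  open Classical in if h : ∃ c, ∃ r > 0, HomothetyAt g x r c then h.choose else 1

variable {H : Subgroup (X ≃ₜ X)} {M : Set X}

theorem scalingFactor_eq {g : X ≃ₜ X} {x : X} {r c : ℝ} (hr : 0 < r) (h : HomothetyAt g x r c)
    (hx : ∀ ε > 0, ∃ y, y ≠ x ∧ dist y x < ε) : scalingFactor g x = c := by
  have hex : ∃ c, ∃ r > 0, HomothetyAt g x r c := ⟨c, r, hr, h⟩
  rw [scalingFactor, dif_pos hex]
  obtain ⟨r', hr', h'⟩ := hex.choose_spec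
  exact h'.eq h hr' hr hx

theorem scalingFactor_mul {g h : X ≃ₜ X} {x : X} (hg : IsLocalHomothety g)
    (hh : IsLocalHomothety h) (hx : ∀ ε > 0, ∃ y, y ≠ x ∧ dist y x < ε)
    (hhx : ∀ ε > 0, ∃ y, y ≠ h x ∧ dist y (h x) < ε) :
    scalingFactor (g * h) x = scalingFactor g (h x) * scalingFactor h x := by
  obtain ⟨r, hr, c, hc⟩ := hh x
  obtain ⟨r', hr', c', hc'⟩ := hg (h x)
  rw [scalingFactor_eq hr hc hx, scalingFactor_eq hr' hc' hhx]
  refine scalingFactor_eq (r := min r (r' / c)) (lt_min hr (div_pos hr' hc.1))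
    (hc'.comp (hc.mono (min_le_left _ _)) ?_) hx
  calc c * min r (r' / c) ≤ c * (r' / c) := by gcongr; exacts [hc.1.le, min_le_right _ _]
    _ = r' := by field_simp [hc.1.ne']

theorem scalingFactor_one {x : X} (hx : ∀ ε > 0, ∃ y, y ≠ x ∧ dist y x < ε) :
    scalingFactor (1 : X ≃ₜ X) x = 1 :=
  scalingFactor_eq one_pos (homothetyAt_id x 1) hx

theorem scalingFactor_pos {g : X ≃ₜ X} {x : X} (hg : IsLocalHomothety g) :
    0 < scalingFactor g x := by
  obtain ⟨r, hr, c, hc⟩ := hg x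
  have hex : ∃ c, ∃ r > 0, HomothetyAt g x r c := ⟨c, r, hr, hc⟩
  rw [scalingFactor, dif_pos hex]
  obtain ⟨r', hr', h'⟩ := hex.choose_spec
  exact h'.1

/-- If the partial products of a word scale by at most `δ / r` times its total scaling factor, then
the inverse of the word is a homothety on the ball of radius `r`. -/
theorem homothetyAt_inv_list_prod {A : Set (X ≃ₜ X)} (hAH : A ⊆ H)
    (hloc : ∀ g ∈ H, IsLocalHomothety g)
    (hinv : ∀ g ∈ H, Set.MapsTo g M M) (hM : ∀ x ∈ M, ∀ ε > 0, ∃ y, y ≠ x ∧ dist y x < ε)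
    {δ : ℝ} (hδ : 0 < δ) (hA : ∀ g ∈ A, ∀ x, ∃ c, HomothetyAt (g⁻¹ : X ≃ₜ X) x δ c)
    {w : List (X ≃ₜ X)} (hw : ∀ g ∈ w, g ∈ A) {x : X} (hx : x ∈ M) {r : ℝ}
    (h : ∀ t, t <:+ w → scalingFactor t.prod x * r ≤ scalingFactor w.prod x * δ) :
    HomothetyAt (w.prod⁻¹ : X ≃ₜ X) (w.prod x) r (scalingFactor w.prod x)⁻¹ := by
  induction w generalizing r with
  | nil =>
    rw [List.prod_nil, scalingFactor_one (hM x hx), inv_one, inv_one]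
    exact homothetyAt_id x r
  | cons s w ih =>
    have hs : s ∈ H := hAH (hw s (by simp))
    have hwA : ∀ g ∈ w, g ∈ A := fun g hg => hw g (by simp [hg])
    have hwH : w.prod ∈ H := H.list_prod_mem fun g hg => hAH (hwA g hg)
    have hwx : w.prod x ∈ M := hinv _ hwH hx
    have hswx : s (w.prod x) ∈ M := hinv _ hs hwx
    have hmul : scalingFactor (s :: w).prod x =
        scalingFactor s (w.prod x) * scalingFactor w.prod x := by
      rw [List.prod_cons, scalingFactor_mul (hloc s hs) (hloc _ hwH) (hM x hx) (hM _ hwx)]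
    have hpw : 0 < scalingFactor w.prod x := scalingFactor_pos (hloc _ hwH)
    have hps : 0 < scalingFactor s (w.prod x) := scalingFactor_pos (hloc _ hs)
    have hrδ : r ≤ δ := by
      have := h (s :: w) List.suffix_rfl
      rw [hmul] at this
      exact le_of_mul_le_mul_left this (mul_pos hps hpw)
    obtain ⟨c, hc⟩ := hA s (hw s (by simp)) (s (w.prod x))
    have hcs : c = (scalingFactor s (w.prod x))⁻¹ := by
      have h1 := scalingFactor_mul (g := s⁻¹) (h := s) (hloc _ (H.inv_mem hs)) (hloc _ hs)
        (hM _ hwx) (hM _ hswx)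
      rw [inv_mul_cancel, scalingFactor_one (hM _ hwx), scalingFactor_eq hδ hc (hM _ hswx)] at h1
      exact eq_inv_of_mul_eq_one_left h1.symm
    have ih' := ih hwA (r := c * r) fun t ht => by
      have := h t (ht.trans (List.suffix_cons s w))
      rw [hmul] at this
      rw [hcs]
      calc scalingFactor t.prod x * ((scalingFactor s (w.prod x))⁻¹ * r)
          = (scalingFactor s (w.prod x))⁻¹ * (scalingFactor t.prod x * r) := by ring
        _ ≤ (scalingFactor s (w.prod x))⁻¹ *
            (scalingFactor s (w.prod x) * scalingFactor w.prod x * δ) := by gcongr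
        _ = scalingFactor w.prod x * δ := by field_simp
    have hfin : HomothetyAt (fun y => (w.prod⁻¹ : X ≃ₜ X) ((s⁻¹ : X ≃ₜ X) y)) (s (w.prod x)) r
        ((scalingFactor w.prod x)⁻¹ * c) := by
      refine HomothetyAt.comp (r' := c * r) ?_ (hc.mono hrδ) le_rfl
      rw [Homeomorph.inv_apply, Homeomorph.symm_apply_apply]
      exact ih'
    rw [hmul, mul_inv, mul_comm, ← hcs, List.prod_cons, mul_inv_rev]
    exact hfin

variable [CompactSpace X] [IsUltrametricDist X] [MeasurableSpace X] [BorelSpace X]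

/-- A finitely generated group of local homotheties without invariant probability measure contains
an element contracting two points of a given minimal set towards each other. -/
theorem IsMinimalSet.exists_contracting_of_not_preserves {S : Set (X ≃ₜ X)} (hS : S.Finite)
    (hloc : ∀ g ∈ Subgroup.closure S, IsLocalHomothety g)
    (hH : ¬ PreservesRegularProbability (Subgroup.closure S))
    (hM : IsMinimalSet (Subgroup.closure S) M) :
    ∃ g ∈ Subgroup.closure S, ∃ y ∈ M, ∃ y' ∈ M, y ≠ y' ∧ ∃ c < 1, 0 < c ∧
      ∀ n : ℕ, dist ((g ^ n) y) ((g ^ n) y') = c ^ n * dist y y' := by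
  have horb := infinite_orbit_of_not_preservesRegularProbability hH
  have hacc : ∀ x ∈ M, ∀ ε > 0, ∃ y, y ≠ x ∧ dist y x < ε := fun x hx ε hε => by
    obtain ⟨y, -, h⟩ := hM.exists_ne_dist_lt horb hx hε
    exact ⟨y, h⟩
  set A : Set (X ≃ₜ X) := S ∪ S⁻¹ with hAdef
  have hAfin : A.Finite := hS.union hS.inv
  have hAH : A ⊆ Subgroup.closure S := by
    rintro g (hg | hg)
    · exact Subgroup.subset_closure hg
    · exact (Subgroup.inv_mem_iff _).1 (Subgroup.subset_closure hg)
  have hAinv : ∀ g ∈ A, g⁻¹ ∈ A := by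
    rintro g (hg | hg)
    · exact Or.inr (by simpa using hg)
    · exact Or.inl hg
  have hword : ∀ g ∈ Subgroup.closure S, ∃ w : List (X ≃ₜ X), (∀ k ∈ w, k ∈ A) ∧ w.prod = g := by
    intro g hg
    rw [← Subgroup.mem_toSubmonoid, Subgroup.closure_toSubmonoid] at hg
    exact Submonoid.exists_list_of_mem_closure hg
  obtain ⟨δ, hδ, hδA⟩ := exists_uniform_homothety hAfin fun g hg => hloc g (hAH hg)
  have hδA' : ∀ g ∈ A, ∀ x, ∃ c, HomothetyAt (g⁻¹ : X ≃ₜ X) x δ c := fun g hg =>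
    hδA _ (hAinv g hg)
  refine hM.exists_contracting horb hloc hδ ?_
  by_contra! hcon
  obtain ⟨c₀, hc₀, hnc⟩ := hcon
  have hnc' : ∀ g ∈ Subgroup.closure S, ∀ y ∈ M, ∀ c, HomothetyAt g y δ c → c₀ ≤ c :=
    fun g hg y hy c hc => by
      by_contra! hlt
      exact hnc g hg y hy c hlt hc
  have hc₀1 : c₀ ≤ 1 := hnc' 1 (Subgroup.one_mem _) _ hM.nonempty.some_mem 1 (homothetyAt_id _ _)
  -- Consider a shortest suffix whose factor exceeds `c₀⁻¹`. All its own suffixes have smaller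
  -- factors, so its inverse is a homothety on a full `δ`-ball with ratio below `c₀`, which is
  -- excluded.
  have hbound : ∀ w : List (X ≃ₜ X), (∀ k ∈ w, k ∈ A) → ∀ x ∈ M, ∀ t, t <:+ w →
      scalingFactor t.prod x ≤ c₀⁻¹ := by
    intro w
    induction w with
    | nil =>
      intro _ x hx t ht
      rw [List.suffix_nil.1 ht, List.prod_nil, scalingFactor_one (hacc x hx)]
      exact (one_le_inv₀ hc₀).2 hc₀1
    | cons s w ih =>
      intro hw x hx t ht
      have ih' := ih (fun k hk => hw k (by simp [hk])) x hx
      rcases List.suffix_cons_iff.1 ht with rfl | ht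
      · by_contra! hlt
        have hmem : (s :: w).prod ∈ Subgroup.closure S :=
          Subgroup.list_prod_mem _ fun g hg => hAH (hw g hg)
        have := homothetyAt_inv_list_prod hAH hloc hM.mapsTo hacc hδ hδA' hw hx (r := δ)
          fun t ht => by
            rcases List.suffix_cons_iff.1 ht with rfl | ht
            · exact le_rfl
            · exact mul_le_mul_of_nonneg_right ((ih' t ht).trans hlt.le) hδ.le
        have h2 := hnc' _ (Subgroup.inv_mem _ hmem) _ (hM.mapsTo _ hmem hx) _ this
        have hpos : 0 < scalingFactor (s :: w).prod x := scalingFactor_pos (hloc _ hmem)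
        rw [le_inv_comm₀ hc₀ hpos] at h2
        exact hlt.not_ge h2
      · exact ih' t ht
  have hD : ∀ g ∈ Subgroup.closure S, ∀ x ∈ M, scalingFactor g x ≤ c₀⁻¹ := by
    intro g hg x hx
    obtain ⟨w, hw, rfl⟩ := hword g hg
    exact hbound w hw x hx w List.suffix_rfl
  refine hH (preservesRegularProbability_of_equicontinuousOn hM.isClosed hM.nonempty hM.mapsTo ?_)
  intro ε hε
  -- One `c₀` in the radius pays for the suffixes of a word for `g⁻¹` at `g x`, whose factors are at
  -- most `c₀⁻¹`, the other for its total factor, at least `c₀`. So `g` is a homothety on this ball,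
  -- with ratio at most `c₀⁻¹`.
  refine ⟨min (c₀ * (c₀ * δ)) (c₀ * ε), by positivity, fun g hg x hx y hy hxy => ?_⟩
  obtain ⟨w, hw, hwg⟩ := hword g⁻¹ (Subgroup.inv_mem _ hg)
  have hgx := hM.mapsTo g hg hx
  have hsg : 0 < scalingFactor g x := scalingFactor_pos (hloc g hg)
  have hsginv : scalingFactor g⁻¹ (g x) = (scalingFactor g x)⁻¹ := by
    have h1 := scalingFactor_mul (g := g⁻¹) (h := g) (hloc _ (Subgroup.inv_mem _ hg)) (hloc g hg)
      (hacc x hx) (hacc _ hgx)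
    rw [inv_mul_cancel, scalingFactor_one (hacc x hx)] at h1
    exact eq_inv_of_mul_eq_one_left h1.symm
  have hhom := homothetyAt_inv_list_prod hAH hloc hM.mapsTo hacc hδ hδA' hw hgx
    (r := c₀ * (c₀ * δ)) fun t ht => by
      have h1 := hbound w hw _ hgx t ht
      have h2 := hD g hg x hx
      rw [hwg, hsginv]
      calc scalingFactor t.prod (g x) * (c₀ * (c₀ * δ)) ≤ c₀⁻¹ * (c₀ * (c₀ * δ)) := by gcongr
        _ = c₀ * δ := by field_simp
        _ ≤ (scalingFactor g x)⁻¹ * δ := by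
          gcongr
          rwa [le_inv_comm₀ hc₀ hsg]
  rw [hwg, hsginv, inv_inv, inv_inv, Homeomorph.inv_apply, Homeomorph.symm_apply_apply] at hhom
  rw [hhom.2 x y (by simpa using by positivity)
    (by rw [dist_comm]; exact hxy.trans_le (min_le_left _ _))]
  calc scalingFactor g x * dist x y ≤ c₀⁻¹ * dist x y := by
        gcongr
        exact hD g hg x hx
    _ < c₀⁻¹ * (c₀ * ε) := by
        gcongr
        exact hxy.trans_le (min_le_right _ _)
    _ = ε := by field_simp

end Derivative

/-! ### Dynamics of a single local homothety -/

section StableSets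

variable {X : Type*} [MetricSpace X]

theorem Homeomorph.pow_add_apply (g : X ≃ₜ X) (m n : ℕ) (x : X) :
    (g ^ (m + n)) x = (g ^ m) ((g ^ n) x) := by
  rw [pow_add, Homeomorph.mul_apply]

theorem Homeomorph.pow_succ_apply' (g : X ≃ₜ X) (n : ℕ) (x : X) :
    (g ^ (n + 1)) x = g ((g ^ n) x) := by
  rw [pow_succ', Homeomorph.mul_apply]

theorem Homeomorph.inv_pow_pow_apply (g : X ≃ₜ X) (n : ℕ) (x : X) :
    (g⁻¹ ^ n) ((g ^ n) x) = x := by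
  rw [inv_pow, ← Homeomorph.mul_apply, inv_mul_cancel, Homeomorph.one_apply]

theorem Homeomorph.pow_inv_pow_apply (g : X ≃ₜ X) (n : ℕ) (x : X) :
    (g ^ n) ((g⁻¹ ^ n) x) = x := by
  rw [inv_pow, ← Homeomorph.mul_apply, mul_inv_cancel, Homeomorph.one_apply]

/-- On the ball of radius `ρ` around a point and on the preimage of the ball of radius `ρ` around
its image, `g` is a homothety. -/
def IsGauge (g : X ≃ₜ X) (ρ : ℝ) : Prop :=
  ∀ x, ∃ c > 0, ∀ u v, (dist u x < ρ ∨ dist (g u) (g x) < ρ) →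
    (dist v x < ρ ∨ dist (g v) (g x) < ρ) → dist (g u) (g v) = c * dist u v

/-- The points whose forward orbit stays `ρ`-close to the one of `x`. -/
def stableSet (g : X ≃ₜ X) (ρ : ℝ) (x : X) : Set X :=
  {y | ∀ k : ℕ, dist ((g ^ k) y) ((g ^ k) x) < ρ}

variable {g : X ≃ₜ X} {ρ : ℝ}

theorem IsGauge.inv (h : IsGauge g ρ) : IsGauge g⁻¹ ρ := by
  intro x
  obtain ⟨c, hc, h⟩ := h (g⁻¹ x)
  refine ⟨c⁻¹, inv_pos.2 hc, fun u v hu hv => ?_⟩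
  have := h (g⁻¹ u) (g⁻¹ v) (by simpa using hu.symm) (by simpa using hv.symm)
  simp only [Homeomorph.inv_apply, Homeomorph.apply_symm_apply] at this
  rw [this, inv_mul_cancel_left₀ hc.ne']
  rfl

theorem IsLocalHomothety.exists_isGauge [CompactSpace X] (hg : IsLocalHomothety g) :
    ∃ ρ > 0, IsGauge g ρ := by
  obtain ⟨δ, hδ, h⟩ := hg.exists_uniform
  obtain ⟨ρ, hρ, hρδ, hinv⟩ := (g⁻¹).exists_dist_apply_lt hδ
  refine ⟨ρ, hρ, fun x => ?_⟩
  obtain ⟨c, hc, hcx⟩ := h x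
  have key : ∀ u, (dist u x < ρ ∨ dist (g u) (g x) < ρ) → dist u x < δ := by
    rintro u (hu | hu)
    · exact hu.trans_le hρδ
    · simpa using hinv _ _ hu
  exact ⟨c, hc, fun u v hu hv => hcx u v (key u hu) (key v hv)⟩

theorem stableSet_pow {x y : X} (h : y ∈ stableSet g ρ x) (n : ℕ) :
    (g ^ n) y ∈ stableSet g ρ ((g ^ n) x) := fun k => by
  rw [← Homeomorph.pow_add_apply, ← Homeomorph.pow_add_apply]
  exact h (k + n)

theorem stableSet_mem_nhds_pow {x : X} (hx : stableSet g ρ x ∈ 𝓝 x) (n : ℕ) :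
    stableSet g ρ ((g ^ n) x) ∈ 𝓝 ((g ^ n) x) := by
  refine Filter.mem_of_superset ((g ^ n).isOpenMap.image_mem_nhds hx) ?_
  rintro _ ⟨y, hy, rfl⟩
  exact stableSet_pow hy n

theorem IsGauge.exists_ratio (h : IsGauge g ρ) (x : X) (k : ℕ) :
    ∃ c > 0, ∀ u ∈ stableSet g ρ x, ∀ v ∈ stableSet g ρ x,
      dist ((g ^ k) u) ((g ^ k) v) = c * dist u v := by
  induction k with
  | zero => exact ⟨1, one_pos, fun u _ v _ => by simp⟩
  | succ k ih =>
    obtain ⟨c, hc, ih⟩ := ih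
    obtain ⟨c', hc', h'⟩ := h ((g ^ k) x)
    refine ⟨c' * c, mul_pos hc' hc, fun u hu v hv => ?_⟩
    rw [Homeomorph.pow_succ_apply', Homeomorph.pow_succ_apply',
      h' _ _ (Or.inl (hu k)) (Or.inl (hv k)), ih u hu v hv, mul_assoc]

/-- As long as both orbits stay `ρ`-close to that of `x`, each step rescales their distances to it
by the same factor, so their order is preserved. -/
theorem IsGauge.mem_stableSet_of_dist_le (h : IsGauge g ρ) {x y z : X}
    (hy : y ∈ stableSet g ρ x) (hz : dist z x ≤ dist y x) : z ∈ stableSet g ρ x := by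
  have key : ∀ k : ℕ, dist ((g ^ k) z) ((g ^ k) x) ≤ dist ((g ^ k) y) ((g ^ k) x) := by
    intro k
    induction k with
    | zero => simpa using hz
    | succ k ih =>
      obtain ⟨c, hc, h'⟩ := h ((g ^ k) x)
      have hx0 : dist ((g ^ k) x) ((g ^ k) x) < ρ := by
        rw [dist_self]
        exact dist_nonneg.trans_lt (hy k)
      simp only [Homeomorph.pow_succ_apply']
      rw [h' _ _ (Or.inl (ih.trans_lt (hy k))) (Or.inl hx0), h' _ _ (Or.inl (hy k)) (Or.inl hx0)]
      exact mul_le_mul_of_nonneg_left ih hc.le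
  exact fun k => (key k).trans_lt (hy k)

/-- If `k` is the first time when the orbits of `x` and `y` are at distance at least `ρ`, then
points whose orbits are `ρ`-close to the one of `x` at time `k` have been closer to it than the
orbit of `y`. -/
theorem IsGauge.dist_lt_of_exit (h : IsGauge g ρ) {x y z : X} {k : ℕ}
    (hlt : ∀ j < k, dist ((g ^ j) y) ((g ^ j) x) < ρ)
    (hk : ρ ≤ dist ((g ^ k) y) ((g ^ k) x)) (hz : dist ((g ^ k) z) ((g ^ k) x) < ρ)
    {j : ℕ} (hj : j ≤ k) : dist ((g ^ j) z) ((g ^ j) x) < dist ((g ^ j) y) ((g ^ j) x) := by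
  induction hj using Nat.decreasingInduction with
  | self => exact hz.trans_le hk
  | of_succ j hj ih =>
    obtain ⟨c, hc, h'⟩ := h ((g ^ j) x)
    have hρ : 0 < ρ := dist_nonneg.trans_lt hz
    have hz' : dist ((g ^ (j + 1)) z) ((g ^ (j + 1)) x) < ρ := by
      rcases (Nat.succ_le_iff.2 hj).eq_or_lt with h1 | h1
      · rw [← Nat.succ_eq_add_one, h1]
        exact hz
      · exact ih.trans (hlt _ h1)
    have hx0 : dist ((g ^ j) x) ((g ^ j) x) < ρ := by simpa using hρ
    simp only [Homeomorph.pow_succ_apply'] at ih hz'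
    -- At time `j` only the image of `z` is known to be close, which is why `IsGauge` includes the
    -- preimage of the ball.
    rw [h' _ _ (Or.inr hz') (Or.inl hx0), h' _ _ (Or.inl (hlt j hj)) (Or.inl hx0)] at ih
    exact lt_of_mul_lt_mul_left ih hc.le

/-- Infinitely many of the points of a sequence lie in a common ball. -/
theorem exists_infinite_dist_lt [CompactSpace X] (hρ : 0 < ρ) (u : ℕ → X) {I : Set ℕ}
    (hI : I.Infinite) :
    ∃ s : X, {i ∈ I | dist (u i) s < ρ}.Infinite := by
  obtain ⟨t, -, ht, hcov⟩ := (isCompact_univ (X := X)).finite_cover_balls hρ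
  by_contra! hcon
  refine hI ((ht.biUnion fun s _ => hcon s).subset fun i hi => ?_)
  obtain ⟨s, hs, hi'⟩ := Set.mem_iUnion₂.1 (hcov (Set.mem_univ (u i)))
  exact Set.mem_biUnion hs ⟨hi, hi'⟩

variable [IsUltrametricDist X]

theorem dist_lt_trans {a b c : X} {r : ℝ} (h : dist a b < r) (h' : dist b c < r) : dist a c < r :=
  (dist_triangle_max _ _ _).trans_lt (max_lt h h')

theorem dist_lt_trans_right {a b c : X} {r : ℝ} (h : dist a b < r) (h' : dist c b < r) :
    dist a c < r :=
  dist_lt_trans h (by rwa [dist_comm])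

variable [CompactSpace X]

/-- Take a point `y` outside the stable set as close to `x` as possible and wait until its orbit
exits at time `k`. Points `ρ`-close at time `k` started strictly closer to `x` than `y`, hence are
stable. -/
theorem IsGauge.exists_ball_subset_stableSet (h : IsGauge g ρ) {x : X}
    (hx : stableSet g ρ x ∈ 𝓝 x) :
    ∃ k : ℕ, Metric.ball ((g ^ k) x) ρ ⊆ stableSet g ρ ((g ^ k) x) := by
  classical
  by_cases hne : (stableSet g ρ x)ᶜ.Nonempty
  swap
  · refine ⟨0, fun y _ => ?_⟩
    rw [Set.not_nonempty_iff_eq_empty, Set.compl_empty_iff] at hne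
    simp [hne]
  obtain ⟨y, hy, hmin⟩ := (isClosed_closure (s := (stableSet g ρ x)ᶜ)).isCompact.exists_isMinOn
    hne.closure (f := fun y => dist y x) (by fun_prop)
  have hyx : y ≠ x := by
    rintro rfl
    rw [closure_compl] at hy
    exact hy (mem_interior_iff_mem_nhds.2 hx)
  -- The minimizer is only known to lie in the closure. If it were stable, a nearby point outside
  -- the stable set would be no farther from `x`, hence stable too.
  have hyW : y ∉ stableSet g ρ x := by
    intro hyW
    obtain ⟨z, hz, hzy⟩ := Metric.mem_closure_iff.1 hy (dist y x) (dist_pos.2 hyx)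
    refine hz (h.mem_stableSet_of_dist_le hyW ?_)
    exact (dist_triangle_max _ y _).trans (max_le (by rw [dist_comm]; exact hzy.le) le_rfl)
  have hex : ∃ k : ℕ, ρ ≤ dist ((g ^ k) y) ((g ^ k) x) := by
    by_contra! hcon
    exact hyW hcon
  refine ⟨Nat.find hex, fun w hw => ?_⟩
  obtain ⟨z, rfl⟩ := (g ^ Nat.find hex).surjective w
  refine stableSet_pow ?_ _
  by_contra hz
  have h1 := h.dist_lt_of_exit (fun j hj => not_le.1 (Nat.find_min hex hj)) (Nat.find_spec hex) hw
    (Nat.zero_le _)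
  have h2 := hmin (subset_closure hz)
  simp only [pow_zero, Homeomorph.one_apply] at h1
  exact (h1.not_ge h2)

/-- Such balls occur at infinitely many times, so by compactness two of their centres are `ρ`-close.
-/
theorem IsGauge.exists_recurrent_ball (h : IsGauge g ρ) (hρ : 0 < ρ) {x : X}
    (hx : stableSet g ρ x ∈ 𝓝 x) :
    ∃ k p : ℕ, 1 ≤ p ∧ Metric.ball ((g ^ k) x) ρ ⊆ stableSet g ρ ((g ^ k) x) ∧
      dist ((g ^ p) ((g ^ k) x)) ((g ^ k) x) < ρ := by
  have hI : {k : ℕ | Metric.ball ((g ^ k) x) ρ ⊆ stableSet g ρ ((g ^ k) x)}.Infinite := by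
    refine Set.infinite_of_forall_exists_gt fun m => ?_
    obtain ⟨k, hk⟩ := h.exists_ball_subset_stableSet (stableSet_mem_nhds_pow hx (m + 1))
    rw [← Homeomorph.pow_add_apply] at hk
    exact ⟨k + (m + 1), hk, by omega⟩
  obtain ⟨s, hs⟩ := exists_infinite_dist_lt hρ (fun k => (g ^ k) x) hI
  obtain ⟨k, hk⟩ := hs.nonempty
  obtain ⟨k', hk', hlt⟩ := hs.exists_gt k
  obtain ⟨p, rfl⟩ := Nat.exists_eq_add_of_lt hlt
  refine ⟨k, p + 1, Nat.le_add_left 1 p, hk.1, ?_⟩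
  rw [← Homeomorph.pow_add_apply, show p + 1 + k = k + p + 1 by ring]
  exact dist_lt_trans_right hk'.2 hk.2

end StableSets

/-! ### Attracted and neutral balls -/

section Attractors

variable {X : Type*} [MetricSpace X] {g : X ≃ₜ X} {ρ : ℝ}

/-- The forward iterates of `g` attract `B` uniformly to the finite set `Φ` of periodic points. -/
def IsAttractedTo (g : X ≃ₜ X) (B Φ : Set X) : Prop :=
  Φ.Finite ∧ (∀ φ ∈ Φ, ∃ p : ℕ, 1 ≤ p ∧ (g ^ p) φ = φ) ∧
    ∀ ε > 0, ∃ n₀ : ℕ, ∀ n ≥ n₀, ∀ u ∈ B, ∃ φ ∈ Φ, dist ((g ^ n) u) φ < ε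

/-- Some iterate of `g` maps `B` isometrically into itself. -/
def IsNeutral (g : X ≃ₜ X) (B : Set X) : Prop :=
  ∃ p : ℕ, 1 ≤ p ∧ Set.MapsTo (g ^ p) B B ∧
    ∀ u ∈ B, ∀ v ∈ B, dist ((g ^ p) u) ((g ^ p) v) = dist u v

/-- For every `ε` the multiples of some iterate of `g` are `ε`-close to the identity on `C`. -/
def IsRecurrentOn (g : X ≃ₜ X) (C : Set X) : Prop :=
  ∀ ε > 0, ∃ N : ℕ, 1 ≤ N ∧ ∀ m : ℕ, ∀ u ∈ C, dist ((g ^ (N * m)) u) u < ε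

theorem Homeomorph.pow_mul_apply_of_fixed {p : ℕ} {x : X} (h : (g ^ p) x = x) (m : ℕ) :
    (g ^ (p * m)) x = x := by
  induction m with
  | zero => simp
  | succ m ih => rw [Nat.mul_succ, Homeomorph.pow_add_apply, h, ih]

theorem Homeomorph.pow_mul_mapsTo {p : ℕ} {B : Set X} (h : Set.MapsTo (g ^ p) B B) (m : ℕ) :
    Set.MapsTo (g ^ (p * m)) B B := by
  induction m with
  | zero => intro x hx; simpa using hx
  | succ m ih =>
    intro x hx
    rw [Nat.mul_succ, Homeomorph.pow_add_apply]
    exact ih (h hx)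

theorem Homeomorph.dist_pow_mul {p : ℕ} {B : Set X} {c : ℝ} (h : Set.MapsTo (g ^ p) B B)
    (hc : ∀ u ∈ B, ∀ v ∈ B, dist ((g ^ p) u) ((g ^ p) v) = c * dist u v) (m : ℕ) {u v : X}
    (hu : u ∈ B) (hv : v ∈ B) :
    dist ((g ^ (p * m)) u) ((g ^ (p * m)) v) = c ^ m * dist u v := by
  induction m generalizing u v with
  | zero => simp
  | succ m ih =>
    rw [Nat.mul_succ, Homeomorph.pow_add_apply, Homeomorph.pow_add_apply, ih (h hu) (h hv),
      hc u hu v hv]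
    ring

theorem Homeomorph.exists_dist_pow_lt [CompactSpace X] (g : X ≃ₜ X) (p : ℕ) {ε : ℝ} (hε : 0 < ε) :
    ∃ η > 0, ∀ j ≤ p, ∀ x y, dist x y < η → dist ((g ^ j) x) ((g ^ j) y) < ε := by
  induction p with
  | zero => exact ⟨ε, hε, fun j hj x y h => by simpa [Nat.le_zero.1 hj] using h⟩
  | succ p ih =>
    obtain ⟨η, hη, h⟩ := ih
    obtain ⟨η', hη', -, h'⟩ := (g ^ (p + 1)).exists_dist_apply_lt hε
    refine ⟨min η η', lt_min hη hη', fun j hj x y hxy => ?_⟩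
    rcases Nat.le_succ_iff.1 hj with hj | rfl
    · exact h j hj x y (hxy.trans_le (min_le_left _ _))
    · exact h' x y (hxy.trans_le (min_le_right _ _))

theorem exists_common_period {s : Set X} (hs : s.Finite)
    (h : ∀ x ∈ s, ∃ p : ℕ, 1 ≤ p ∧ (g ^ p) x = x) :
    ∃ P : ℕ, 1 ≤ P ∧ ∀ x ∈ s, (g ^ P) x = x := by
  induction s, hs using Set.Finite.induction_on with
  | empty => exact ⟨1, le_rfl, fun x hx => absurd hx (Set.notMem_empty x)⟩
  | @insert a s _ _ ih =>
    obtain ⟨P, hP, hPs⟩ := ih fun x hx => h x (Or.inr hx)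
    obtain ⟨p, hp, hpa⟩ := h a (Or.inl rfl)
    refine ⟨p * P, Nat.mul_pos hp hP, ?_⟩
    rintro x (rfl | hx)
    · exact Homeomorph.pow_mul_apply_of_fixed hpa P
    · rw [mul_comm]
      exact Homeomorph.pow_mul_apply_of_fixed (hPs x hx) p

theorem IsRecurrentOn.biUnion {ι : Type*} {s : Set ι} (hs : s.Finite) {C : ι → Set X}
    (h : ∀ i ∈ s, IsRecurrentOn g (C i)) : IsRecurrentOn g (⋃ i ∈ s, C i) := by
  intro ε hε
  induction s, hs using Set.Finite.induction_on with
  | empty => exact ⟨1, le_rfl, fun m u hu => by simp at hu⟩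
  | @insert a s _ _ ih =>
    obtain ⟨N, hN, hNs⟩ := ih fun i hi => h i (Or.inr hi)
    obtain ⟨N', hN', hNa⟩ := h a (Or.inl rfl) ε hε
    refine ⟨N * N', Nat.mul_pos hN hN', fun m u hu => ?_⟩
    rw [Set.biUnion_insert] at hu
    rcases hu with hu | hu
    · rw [mul_comm N, mul_assoc]
      exact hNa _ u hu
    · rw [mul_assoc]
      exact hNs _ u hu

theorem IsRecurrentOn.image_pow [CompactSpace X] {C : Set X} (h : IsRecurrentOn g C) (j : ℕ) :
    IsRecurrentOn g ((g ^ j) '' C) := by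
  intro ε hε
  obtain ⟨η, hη, -, hj⟩ := (g ^ j).exists_dist_apply_lt hε
  obtain ⟨N, hN, hC⟩ := h η hη
  refine ⟨N, hN, ?_⟩
  rintro m _ ⟨u, hu, rfl⟩
  rw [← Homeomorph.pow_add_apply, add_comm, Homeomorph.pow_add_apply]
  exact hj _ _ (hC m u hu)

/-- A closed, forward invariant and recurrent set is backward invariant. -/
theorem IsRecurrentOn.mem_of_pow_mem [CompactSpace X] {C : Set X} (h : IsRecurrentOn g C)
    (hC : IsClosed C) (hinv : Set.MapsTo g C C) {k : ℕ} {x : X} (hx : (g ^ k) x ∈ C) : x ∈ C := by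
  rw [← hC.closure_eq, Metric.mem_closure_iff]
  intro ε hε
  obtain ⟨η, hη, -, hk⟩ := (g⁻¹ ^ k).exists_dist_apply_lt hε
  obtain ⟨N, hN, hNC⟩ := h η hη
  have hpow : ∀ n : ℕ, Set.MapsTo (g ^ n) C C := fun n => by
    have := Homeomorph.pow_mul_mapsTo (g := g) (p := 1) (by simpa using hinv) n
    rwa [one_mul] at this
  have hle : k ≤ N * k := Nat.le_mul_of_pos_left k hN
  refine ⟨(g ^ (N * k - k)) ((g ^ k) x), hpow _ hx, ?_⟩
  have := hk _ _ (hNC k _ hx)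
  rw [dist_comm, Homeomorph.inv_pow_pow_apply, show N * k = k + (N * k - k) by omega,
    Homeomorph.pow_add_apply, Homeomorph.inv_pow_pow_apply] at this
  exact this

variable [IsUltrametricDist X] [CompactSpace X]

/-- By pigeonhole two iterates of the isometry agree up to `ε` on a finite `ε`-net. Cancelling the
earlier one leaves an iterate `ε`-close to the identity; its powers stay so by the ultrametric
inequality. -/
theorem IsNeutral.isRecurrentOn {B : Set X} (hB : IsClosed B) (h : IsNeutral g B) :
    IsRecurrentOn g B := by
  obtain ⟨p, hp, hmaps, hiso⟩ := h
  intro ε hε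
  have hmp := Homeomorph.pow_mul_mapsTo hmaps
  have hisom : ∀ m, ∀ u ∈ B, ∀ v ∈ B,
      dist ((g ^ (p * m)) u) ((g ^ (p * m)) v) = dist u v := fun m u hu v hv => by
    simpa using Homeomorph.dist_pow_mul (c := 1) hmaps (by simpa using hiso) m hu hv
  obtain ⟨t, htB, ht, hcov⟩ := hB.isCompact.finite_cover_balls hε
  have hcov' : ∀ u : B, ∃ s : t, dist (u : X) s < ε := fun u => by
    obtain ⟨s, hs, hus⟩ := Set.mem_iUnion₂.1 (hcov u.2)
    exact ⟨⟨s, hs⟩, hus⟩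
  choose κ hκ using hcov'
  have : Finite t := ht
  obtain ⟨i, i', hne, hii⟩ := Finite.exists_ne_map_eq_of_infinite
    fun i : ℕ => fun s : t => κ ⟨(g ^ (p * i)) s, hmp i (htB s.2)⟩
  wlog hlt : i < i' generalizing i i'
  · exact this i' i hne.symm hii.symm (lt_of_le_of_ne (not_lt.1 hlt) hne.symm)
  obtain ⟨n, rfl⟩ := Nat.exists_eq_add_of_lt hlt
  have hone : ∀ u ∈ B, dist ((g ^ (p * (n + 1))) u) u < ε := by
    intro u hu
    have hus := hκ ⟨u, hu⟩
    set s := κ ⟨u, hu⟩ with hs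
    have e := congrFun hii s
    have h1 := hκ ⟨(g ^ (p * i)) s, hmp i (htB s.2)⟩
    have h2 := hκ ⟨(g ^ (p * (i + n + 1))) s, hmp (i + n + 1) (htB s.2)⟩
    rw [← e] at h2
    have h3 : dist ((g ^ (p * (i + n + 1))) s) ((g ^ (p * i)) s) < ε := dist_lt_trans_right h2 h1
    have h4 : dist ((g ^ (p * (n + 1))) s) s < ε := by
      rw [← hisom i _ (hmp _ (htB s.2)) _ (htB s.2), ← Homeomorph.pow_add_apply, ← mul_add]
      exact h3
    have h5 : dist ((g ^ (p * (n + 1))) u) ((g ^ (p * (n + 1))) s) < ε := by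
      rwa [hisom _ _ hu _ (htB s.2)]
    exact dist_lt_trans_right (dist_lt_trans h5 h4) hus
  refine ⟨p * (n + 1), Nat.mul_pos hp (Nat.succ_pos n), fun m u hu => ?_⟩
  induction m with
  | zero => simpa using hε
  | succ m ih =>
    rw [Nat.mul_succ, Homeomorph.pow_add_apply]
    refine dist_lt_trans ?_ ih
    rw [mul_assoc, hisom _ _ (hmp _ hu) _ hu]
    exact hone u hu

/-- The map `g ^ p` sends the ball into itself with a constant ratio. Ratio below 1 gives a fixed
point and attraction to its orbit, ratio 1 an isometry. Ratio above 1 is compatible with bounded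
distances only if the ball is a single point. -/
theorem IsGauge.isAttractedTo_or_isNeutral (h : IsGauge g ρ) {y : X} {p : ℕ} (hp : 1 ≤ p)
    (hy : Metric.ball y ρ ⊆ stableSet g ρ y) (hpy : dist ((g ^ p) y) y < ρ) :
    (∃ Φ, IsAttractedTo g (Metric.ball y ρ) Φ) ∨ IsNeutral g (Metric.ball y ρ) := by
  have hρ : 0 < ρ := dist_nonneg.trans_lt hpy
  set B := Metric.ball y ρ with hB
  have hmaps : Set.MapsTo (g ^ p) B B := fun u hu => dist_lt_trans (hy hu p) hpy
  have hBd : ∀ u ∈ B, ∀ v ∈ B, dist u v < ρ := fun u hu v hv => dist_lt_trans_right hu hv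
  choose c hc hcd using h.exists_ratio y
  have hcB : ∀ k, ∀ u ∈ B, ∀ v ∈ B, dist ((g ^ k) u) ((g ^ k) v) = c k * dist u v :=
    fun k u hu v hv => hcd k u (hy hu) v (hy hv)
  rcases lt_trichotomy (c p) 1 with hlt | heq | hgt
  · left
    have hcl : IsCompact B := (IsUltrametricDist.isClosed_ball y ρ).isCompact
    -- A point of least displacement is fixed, since a contraction would shorten a positive
    -- displacement.
    obtain ⟨a, ha, hmin⟩ := hcl.exists_isMinOn ⟨y, Metric.mem_ball_self hρ⟩
      (f := fun u => dist ((g ^ p) u) u)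
      ((g ^ p).continuous.dist continuous_id).continuousOn
    have hfix : (g ^ p) a = a := by
      by_contra hne
      have h1 : dist ((g ^ p) a) a ≤ dist ((g ^ p) ((g ^ p) a)) ((g ^ p) a) := hmin (hmaps ha)
      rw [hcB p _ (hmaps ha) _ ha] at h1
      have h2 : 0 < dist ((g ^ p) a) a := dist_pos.2 hne
      nlinarith
    refine ⟨(fun j => (g ^ j) a) '' Set.Iio p, (Set.finite_Iio p).image _, ?_, ?_⟩
    · rintro _ ⟨j, -, rfl⟩
      refine ⟨p, hp, ?_⟩
      change (g ^ p) ((g ^ j) a) = (g ^ j) a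
      rw [← Homeomorph.pow_add_apply, add_comm, Homeomorph.pow_add_apply, hfix]
    · intro ε hε
      obtain ⟨η, hη, hpη⟩ := g.exists_dist_pow_lt p hε
      obtain ⟨m₀, hm₀⟩ := exists_pow_lt_of_lt_one (div_pos hη hρ) hlt
      refine ⟨p * m₀, fun n hn u hu => ?_⟩
      refine ⟨(g ^ (n % p)) a, ⟨n % p, Nat.mod_lt n hp, rfl⟩, ?_⟩
      rw [← Nat.mod_add_div n p, Homeomorph.pow_add_apply]
      rw [Nat.add_mul_mod_self_left, Nat.mod_mod]
      refine hpη _ (Nat.mod_lt n hp).le _ _ ?_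
      have hm : m₀ ≤ n / p := (Nat.le_div_iff_mul_le hp).2 (by rwa [mul_comm])
      rw [← Homeomorph.pow_mul_apply_of_fixed hfix (n / p),
        Homeomorph.dist_pow_mul hmaps (hcB p) _ hu ha]
      calc c p ^ (n / p) * dist u a ≤ c p ^ m₀ * ρ :=
            mul_le_mul (pow_le_pow_of_le_one (hc p).le hlt.le hm) (hBd u hu a ha).le dist_nonneg
              (pow_nonneg (hc p).le _)
        _ < η / ρ * ρ := by gcongr
        _ = η := by field_simp
  · right
    exact ⟨p, hp, hmaps, fun u hu v hv => by rw [hcB p u hu v hv, heq, one_mul]⟩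
  · right
    refine ⟨p, hp, hmaps, fun u hu v hv => ?_⟩
    suffices huv : dist u v = 0 by rw [hcB p u hu v hv, huv, mul_zero]
    by_contra hne
    have hpos : 0 < dist u v := lt_of_le_of_ne dist_nonneg (Ne.symm hne)
    obtain ⟨m, hm⟩ := pow_unbounded_of_one_lt (ρ / dist u v) hgt
    have h1 := hBd _ (Homeomorph.pow_mul_mapsTo hmaps m hu) _
      (Homeomorph.pow_mul_mapsTo hmaps m hv)
    rw [Homeomorph.dist_pow_mul hmaps (hcB p) _ hu hv] at h1
    rw [div_lt_iff₀ hpos] at hm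
    linarith

/-- In a compact ultrametric space there are only finitely many balls of radius `ρ`, so one finite
set serves them all. -/
theorem exists_attractor (g : X ≃ₜ X) (hρ : 0 < ρ) :
    ∃ Φ : Set X, Φ.Finite ∧ (∀ φ ∈ Φ, ∃ p : ℕ, 1 ≤ p ∧ (g ^ p) φ = φ) ∧
      ∀ y, (∃ Φ', IsAttractedTo g (Metric.ball y ρ) Φ') → IsAttractedTo g (Metric.ball y ρ) Φ := by
  classical
  obtain ⟨t, -, ht, hcov⟩ := (isCompact_univ (X := X)).finite_cover_balls hρ
  let F : X → Set X := fun s =>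
    if h : ∃ Φ', IsAttractedTo g (Metric.ball s ρ) Φ' then h.choose else ∅
  have hF : ∀ s, (∃ Φ', IsAttractedTo g (Metric.ball s ρ) Φ') →
      IsAttractedTo g (Metric.ball s ρ) (F s) := fun s hs => by
    simp only [F, dif_pos hs]
    exact hs.choose_spec
  have hF' : ∀ s, (F s).Finite ∧ ∀ φ ∈ F s, ∃ p : ℕ, 1 ≤ p ∧ (g ^ p) φ = φ := fun s => by
    by_cases hs : ∃ Φ', IsAttractedTo g (Metric.ball s ρ) Φ'
    · exact ⟨(hF s hs).1, (hF s hs).2.1⟩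
    · simp [F, dif_neg hs]
  have hfin : (⋃ s ∈ t, F s).Finite := ht.biUnion fun s _ => (hF' s).1
  have hper : ∀ φ ∈ ⋃ s ∈ t, F s, ∃ p : ℕ, 1 ≤ p ∧ (g ^ p) φ = φ := fun φ hφ => by
    obtain ⟨s, -, hφ⟩ := Set.mem_iUnion₂.1 hφ
    exact (hF' s).2 φ hφ
  refine ⟨⋃ s ∈ t, F s, hfin, hper, fun y hy => ⟨hfin, hper, fun ε hε => ?_⟩⟩
  obtain ⟨s, hs, hys⟩ := Set.mem_iUnion₂.1 (hcov (Set.mem_univ y))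
  rw [← IsUltrametricDist.ball_eq_of_mem hys] at hy ⊢
  obtain ⟨n₀, hn₀⟩ := (hF s hy).2.2 ε hε
  refine ⟨n₀, fun n hn u hu => ?_⟩
  obtain ⟨φ, hφ, h⟩ := hn₀ n hn u hu
  exact ⟨φ, Set.mem_biUnion hs hφ, h⟩

/-- The neutral balls lie in a clopen invariant set on which `g` is recurrent. -/
theorem exists_neutral_set (g : X ≃ₜ X) (hρ : 0 < ρ) :
    ∃ K : Set X, IsClosed K ∧ IsOpen K ∧ Set.MapsTo g K K ∧ IsRecurrentOn g K ∧
      ∀ y, IsNeutral g (Metric.ball y ρ) → y ∈ K := by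
  obtain ⟨t, -, ht, hcov⟩ := (isCompact_univ (X := X)).finite_cover_balls hρ
  let s : Set X := {x ∈ t | IsNeutral g (Metric.ball x ρ)}
  have hs : s.Finite := ht.subset (Set.sep_subset _ _)
  choose! p hp hmaps hiso using fun x (hx : x ∈ s) => hx.2
  have hfin : ∀ x, (Set.Iio (p x)).Finite := fun x => Set.finite_Iio _
  refine ⟨⋃ x ∈ s, ⋃ j ∈ Set.Iio (p x), (g ^ j) '' Metric.ball x ρ, ?_, ?_, ?_, ?_, ?_⟩
  · exact hs.isClosed_biUnion fun x _ => (hfin x).isClosed_biUnion fun j _ =>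
      (g ^ j).isClosed_image.2 (IsUltrametricDist.isClosed_ball x ρ)
  · exact isOpen_biUnion fun x _ => isOpen_biUnion fun j _ =>
      (g ^ j).isOpen_image.2 Metric.isOpen_ball
  · intro z hz
    obtain ⟨x, hx, hz⟩ := Set.mem_iUnion₂.1 hz
    obtain ⟨j, hj, u, hu, rfl⟩ := Set.mem_iUnion₂.1 hz
    refine Set.mem_biUnion hx ?_
    rw [← Homeomorph.pow_succ_apply']
    rcases (Nat.succ_le_iff.2 hj).eq_or_lt with h | h
    · refine Set.mem_biUnion (x := 0) (hp x hx) ⟨_, hmaps x hx hu, ?_⟩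
      rw [← Nat.succ_eq_add_one, h]
      simp
    · exact Set.mem_biUnion (x := j + 1) h ⟨u, hu, rfl⟩
  · exact IsRecurrentOn.biUnion hs fun x hx => IsRecurrentOn.biUnion (hfin x) fun j _ =>
      (IsNeutral.isRecurrentOn (IsUltrametricDist.isClosed_ball x ρ) hx.2).image_pow j
  · intro y hy
    obtain ⟨x, hx, hyx⟩ := Set.mem_iUnion₂.1 (hcov (Set.mem_univ y))
    rw [← IsUltrametricDist.ball_eq_of_mem hyx] at hy
    have hxs : x ∈ s := ⟨hx, hy⟩
    exact Set.mem_biUnion hxs (Set.mem_biUnion (x := 0) (hp x hxs) ⟨y, hyx, by simp⟩)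

end Attractors

/-! ### Unstable points, and collapsing by powers of one map -/

section Collapse

variable {X : Type*} [MetricSpace X] [CompactSpace X] {g : X ≃ₜ X} {ρ : ℝ}

/-- At an unstable point there are arbitrarily late times at which the `ρ`-ball around the orbit
pulls back to a small ball without ever having been large. -/
theorem IsGauge.exists_pullback (h : IsGauge g ρ) {x : X} (hx : stableSet g ρ x ∉ 𝓝 x)
    {ε : ℝ} (hε : 0 < ε) (hρ : 0 < ρ) (m : ℕ) :
    ∃ k ≥ m, ∀ z, dist ((g ^ k) z) ((g ^ k) x) < ρ →
      (∀ j ≤ k, dist ((g ^ j) z) ((g ^ j) x) < ρ) ∧ dist z x < ε := by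
  classical
  obtain ⟨η, hη, hηm⟩ := g.exists_dist_pow_lt m hρ
  obtain ⟨y, hyW, hy⟩ : ∃ y, y ∉ stableSet g ρ x ∧ dist y x < min η ε := by
    by_contra! hcon
    refine hx (Filter.mem_of_superset (Metric.ball_mem_nhds x (lt_min hη hε)) fun y hy => ?_)
    by_contra hyW
    exact (hcon y hyW).not_gt hy
  have hex : ∃ k : ℕ, ρ ≤ dist ((g ^ k) y) ((g ^ k) x) := by
    by_contra! hcon
    exact hyW hcon
  have hmin : ∀ j < Nat.find hex, dist ((g ^ j) y) ((g ^ j) x) < ρ :=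
    fun j hj => not_le.1 (Nat.find_min hex hj)
  refine ⟨Nat.find hex, ?_, fun z hz => ?_⟩
  · by_contra! hlt
    exact (Nat.find_spec hex).not_gt (hηm _ hlt.le _ _ (hy.trans_le (min_le_left _ _)))
  · have hexit := fun j (hj : j ≤ Nat.find hex) =>
      h.dist_lt_of_exit hmin (Nat.find_spec hex) hz hj
    refine ⟨fun j hj => ?_, ?_⟩
    · rcases hj.eq_or_lt with rfl | hj
      · exact hz
      · exact (hexit j hj.le).trans (hmin j hj)
    · have := hexit 0 (Nat.zero_le _)
      simp only [pow_zero, Homeomorph.one_apply] at this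
      exact this.trans (hy.trans_le (min_le_right _ _))

/-- Two points of a neutral ball do not get arbitrarily close. -/
theorem IsNeutral.eq_of_forall_exists_dist_lt {B : Set X} (h : IsNeutral g B) {u v : X}
    (hu : u ∈ B) (hv : v ∈ B) (hlim : ∀ ε > 0, ∃ n : ℕ, dist ((g ^ n) u) ((g ^ n) v) < ε) :
    u = v := by
  obtain ⟨p, hp, hmaps, hiso⟩ := h
  by_contra hne
  obtain ⟨η, hη, hpη⟩ := g.exists_dist_pow_lt p (dist_pos.2 hne)
  obtain ⟨n, hn⟩ := hlim η hη
  -- These extra iterations complete `n` to a multiple of `p`, at which time the original distance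
  -- is restored.
  have h1 := hpη (p - n % p) (Nat.sub_le _ _) _ _ hn
  have h2 := Homeomorph.dist_pow_mul (c := 1) hmaps (by simpa using hiso) (n / p + 1) hu hv
  rw [one_pow, one_mul] at h2
  have hlt := Nat.mod_lt n hp
  have h3 : p - n % p + n = p * (n / p + 1) := by
    have := Nat.mod_add_div n p
    rw [mul_add, mul_one]
    omega
  rw [← Homeomorph.pow_add_apply, ← Homeomorph.pow_add_apply, h3, h2] at h1
  exact lt_irrefl _ h1

variable [IsUltrametricDist X]

/-- Unstable points belong to the attractor of the inverse. -/
theorem IsGauge.mem_repeller (h : IsGauge g ρ) (hρ : 0 < ρ) {R : Set X}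
    (hR : ∀ y, (∃ Φ, IsAttractedTo g⁻¹ (Metric.ball y ρ) Φ) →
      IsAttractedTo g⁻¹ (Metric.ball y ρ) R) {x : X} (hx : stableSet g ρ x ∉ 𝓝 x) : x ∈ R := by
  choose k hk hkz using fun i : ℕ =>
    h.exists_pullback hx (ε := 1 / ((i : ℝ) + 1)) Nat.one_div_pos_of_nat hρ i
  obtain ⟨s, hs⟩ := exists_infinite_dist_lt hρ (fun i => (g ^ k i) x) Set.infinite_univ
  simp only [Set.mem_univ, true_and] at hs
  have hback : ∀ i, dist ((g ^ k i) x) s < ρ → ∀ w, dist w s < ρ →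
      (∀ j ≤ k i, dist ((g⁻¹ ^ j) w) ((g⁻¹ ^ j) ((g ^ k i) x)) < ρ) ∧
        dist ((g⁻¹ ^ k i) w) x < 1 / ((i : ℝ) + 1) := by
    intro i hi w hw
    obtain ⟨z, rfl⟩ := (g ^ k i).surjective w
    obtain ⟨h1, h2⟩ := hkz i z (dist_lt_trans_right hw hi)
    refine ⟨fun j hj => ?_, by rwa [Homeomorph.inv_pow_pow_apply]⟩
    obtain ⟨l, hl⟩ := Nat.exists_eq_add_of_le hj
    rw [hl, Homeomorph.pow_add_apply, Homeomorph.pow_add_apply, Homeomorph.inv_pow_pow_apply,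
      Homeomorph.inv_pow_pow_apply]
    exact h1 l (by omega)
  -- Arbitrarily long stretches of backward orbits from the ball around `s` stay together and end
  -- near `x`, so this ball is stable for `g⁻¹`.
  have hfull : Metric.ball s ρ ⊆ stableSet g⁻¹ ρ s := by
    intro w hw j
    obtain ⟨i, hi, hij⟩ := hs.exists_gt j
    have hji : j ≤ k i := hij.le.trans (hk i)
    exact dist_lt_trans_right ((hback i hi w hw).1 j hji)
      ((hback i hi s (by simpa using hρ)).1 j hji)
  obtain ⟨l, p, hp, hlball, hlp⟩ := h.inv.exists_recurrent_ball hρ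
    (Filter.mem_of_superset (Metric.ball_mem_nhds s hρ) hfull)
  have hBl : ∀ w, dist w s < ρ → (g⁻¹ ^ l) w ∈ Metric.ball ((g⁻¹ ^ l) s) ρ :=
    fun w hw => hfull hw l
  rcases h.inv.isAttractedTo_or_isNeutral hp hlball hlp with hatt | hneu
  · obtain ⟨hRfin, -, hRn⟩ := hR _ hatt
    rw [← hRfin.isClosed.closure_eq, Metric.mem_closure_iff]
    intro ε hε
    obtain ⟨n₀, hn₀⟩ := hRn ε hε
    obtain ⟨i, hi, hin⟩ := hs.exists_gt (n₀ + l)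
    obtain ⟨r, hr, hd⟩ := hn₀ (k i - l) (by have := hk i; omega) _ (hBl _ hi)
    rw [← Homeomorph.pow_add_apply, Nat.sub_add_cancel (by have := hk i; omega),
      Homeomorph.inv_pow_pow_apply] at hd
    exact ⟨r, hr, hd⟩
  -- An unstable point is not isolated, so some `z ≠ x` reaches the same ball. Backward iteration
  -- brings the two images arbitrarily close, which a neutral ball forbids.
  · exfalso
    obtain ⟨i₀, hi₀⟩ := hs.nonempty
    have hev : ∀ᶠ z in 𝓝 x, dist ((g ^ k i₀) z) s < ρ :=
      ((g ^ k i₀).continuous.dist continuous_const).continuousAt.eventually (gt_mem_nhds hi₀)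
    obtain ⟨z, hz, hzx⟩ : ∃ z, dist ((g ^ k i₀) z) s < ρ ∧ z ≠ x := by
      by_contra! hcon
      refine hx (Filter.mem_of_superset hev fun z hz => ?_)
      rw [hcon z hz]
      intro j
      simpa using hρ
    have heq := hneu.eq_of_forall_exists_dist_lt (hBl _ hz) (hBl _ hi₀) fun ε hε => by
      obtain ⟨N, hN⟩ := exists_nat_one_div_lt hε
      obtain ⟨i, hi, hin⟩ := hs.exists_gt (N + l)
      have hε' : 1 / ((i : ℝ) + 1) < ε := (Nat.one_div_le_one_div (by omega)).trans_lt hN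
      refine ⟨k i - l, ?_⟩
      have hle : k i - l + l = k i := Nat.sub_add_cancel (by have := hk i; omega)
      rw [← Homeomorph.pow_add_apply, ← Homeomorph.pow_add_apply, hle]
      exact (dist_lt_trans_right (hback i hi _ hz).2 (hback i hi _ hi₀).2).trans hε'
    exact hzx ((g ^ k i₀).injective ((g⁻¹ ^ l).injective heq))

/-- The powers of a local homothety of a compact ultrametric space are recurrent on a closed set and
collapse its complement to finitely many points. -/
theorem IsLocalHomothety.exists_collapses (hg : IsLocalHomothety g) :
    ∃ K, IsClosed K ∧ Collapses (positivePowers g) K := by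
  obtain ⟨ρ, hρ, h⟩ := hg.exists_isGauge
  obtain ⟨Φ, hΦ, -, hΦatt⟩ := exists_attractor g hρ
  obtain ⟨R, hR, hRper, hRatt⟩ := exists_attractor g⁻¹ hρ
  obtain ⟨K, hKc, hKo, hKinv, hKrec, hKneu⟩ := exists_neutral_set g hρ
  refine ⟨K, hKc, R, Φ ∪ R, hR, hΦ.union hR, fun ε hε => ?_⟩
  obtain ⟨P, hP, hPR⟩ := exists_common_period (g := g) hR fun r hr => by
    obtain ⟨p, hp, hpr⟩ := hRper r hr
    refine ⟨p, hp, ?_⟩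
    conv_lhs => rw [← hpr]
    exact g.pow_inv_pow_apply p r
  obtain ⟨N, hN, hNK⟩ := hKrec ε hε
  have hC : IsCompact {x | x ∉ K ∧ ∀ r ∈ R, ε ≤ dist x r} := by
    have : {x | x ∉ K ∧ ∀ r ∈ R, ε ≤ dist x r} = Kᶜ ∩ ⋂ r ∈ R, {x | ε ≤ dist x r} := by
      ext x
      simp
    rw [this]
    exact (hKo.isClosed_compl.inter (isClosed_biInter fun r _ =>
      isClosed_le continuous_const (continuous_id.dist continuous_const))).isCompact
  obtain ⟨n₁, hn₁⟩ : ∃ n₁ : ℕ, ∀ x ∈ {x | x ∉ K ∧ ∀ r ∈ R, ε ≤ dist x r}, ∀ n ≥ n₁,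
      ∃ φ ∈ Φ, dist ((g ^ n) x) φ < ε := by
    refine hC.induction_on (p := fun s => ∃ n₁ : ℕ, ∀ x ∈ s, ∀ n ≥ n₁,
      ∃ φ ∈ Φ, dist ((g ^ n) x) φ < ε) ⟨0, fun x hx => absurd hx (Set.notMem_empty x)⟩ ?_ ?_ ?_
    · rintro s t hst ⟨n₁, h⟩
      exact ⟨n₁, fun x hx => h x (hst hx)⟩
    · rintro s t ⟨n₁, h₁⟩ ⟨n₂, h₂⟩
      refine ⟨max n₁ n₂, ?_⟩
      rintro x (hx | hx) n hn
      · exact h₁ x hx n ((le_max_left _ _).trans hn)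
      · exact h₂ x hx n ((le_max_right _ _).trans hn)
    · rintro x ⟨hxK, hxR⟩
      have hst : stableSet g ρ x ∈ 𝓝 x := by
        by_contra hst
        have := hxR x (h.mem_repeller hρ hRatt hst)
        rw [dist_self] at this
        exact this.not_gt hε
      obtain ⟨k, p, hp, hkball, hkp⟩ := h.exists_recurrent_ball hρ hst
      rcases h.isAttractedTo_or_isNeutral hp hkball hkp with hatt | hneu
      · obtain ⟨n₀, hn₀⟩ := (hΦatt _ hatt).2.2 ε hε
        refine ⟨_, mem_nhdsWithin_of_mem_nhds ((g ^ k).continuous.continuousAt.preimage_mem_nhds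
          (Metric.ball_mem_nhds _ hρ)), n₀ + k, fun u hu n hn => ?_⟩
        have := hn₀ (n - k) (by omega) _ hu
        rwa [← Homeomorph.pow_add_apply, Nat.sub_add_cancel (by omega)] at this
      · exact absurd (hKrec.mem_of_pow_mem hKc hKinv (hKneu _ hneu)) hxK
  -- The exponent is a multiple of `N` to be nearly the identity on `K`, a multiple of `P` to fix
  -- `R`, and at least `n₁` to collapse the rest.
  have hpos : 1 ≤ N * P * (n₁ + 1) := Nat.mul_pos (Nat.mul_pos hN hP) (Nat.succ_pos _)
  refine ⟨_, ⟨N * P * (n₁ + 1), hpos, rfl⟩, fun x hxK hxR => ?_, fun x hx => ?_⟩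
  · by_cases hx : x ∈ R
    · refine ⟨x, Or.inr hx, ?_⟩
      rw [mul_comm N, mul_assoc, Homeomorph.pow_mul_apply_of_fixed (hPR x hx), dist_self]
      exact hε
    · obtain ⟨φ, hφ, hd⟩ := hn₁ x ⟨hxK, fun r hr => (hxR r hr).resolve_left
        fun h => hx (h ▸ hr)⟩ (N * P * (n₁ + 1)) (by
          calc n₁ ≤ 1 * (n₁ + 1) := by omega
            _ ≤ N * P * (n₁ + 1) := Nat.mul_le_mul_right _ (Nat.mul_pos hN hP))
      exact ⟨φ, Or.inl hφ, hd⟩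
  · rw [mul_assoc]
    exact hNK _ x hx

end Collapse

/-! ### The dynamical Tits alternative for groups of local homotheties -/

section TitsAlternative

variable {X : Type*} [MetricSpace X] [CompactSpace X] [IsUltrametricDist X] [MeasurableSpace X]
  [BorelSpace X]

theorem exists_isPingPongPair_of_finite {S : Set (X ≃ₜ X)} (hS : S.Finite)
    (hloc : ∀ g ∈ Subgroup.closure S, IsLocalHomothety g)
    (hH : ¬ PreservesRegularProbability (Subgroup.closure S)) :
    ∃ g ∈ Subgroup.closure S, ∃ h ∈ Subgroup.closure S, IsPingPongPair g h := by
  set H := Subgroup.closure S with hHdef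
  let F : Set (Set X) := {K | IsClosed K ∧ ∃ g ∈ H, Collapses (positivePowers g) K}
  have hFH : ∀ K ∈ F, Collapses (H : Set (X ≃ₜ X)) K := by
    rintro K ⟨-, g, hg, hK⟩
    refine hK.mono ?_
    rintro _ ⟨n, -, rfl⟩
    exact H.pow_mem hg n
  suffices hempty : ⋂₀ F = ∅ by
    obtain ⟨t, htF, ht, hte⟩ : ∃ t ⊆ F, t.Finite ∧ ⋂₀ t = ∅ := by
      rw [Set.sInter_eq_iInter] at hempty
      obtain ⟨u, hu⟩ := isCompact_univ.elim_finite_subfamily_closed (fun K : F => (K : Set X))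
        (fun K => K.2.1) (by rw [hempty, Set.inter_empty])
      refine ⟨Subtype.val '' (u : Set F), ?_, u.finite_toSet.image _, ?_⟩
      · rintro _ ⟨K, -, rfl⟩
        exact K.2
      · rw [Set.sInter_image]
        simpa using hu
    refine Collapses.exists_isPingPongPair ?_ (infinite_orbit_of_not_preservesRegularProbability hH)
    rw [← hte]
    clear hte
    induction t, ht using Set.Finite.induction_on with
    | empty => rw [Set.sInter_empty]; exact collapses_univ H
    | @insert K t _ _ ih =>
      rw [Set.sInter_insert]
      exact (hFH K (htF (Or.inl rfl))).inter (ih fun K' hK' => htF (Or.inr hK'))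
  by_contra hne
  rw [← Ne, ← Set.nonempty_iff_ne_empty] at hne
  obtain ⟨M, hMF, hM⟩ := exists_isMinimalSet_subset (H := H)
    (isClosed_sInter fun K hK => hK.1) hne (by
      rintro k hk x hx K ⟨hK, g, hg, hc⟩
      have : (k⁻¹ : X ≃ₜ X) '' K ∈ F := by
        refine ⟨(k⁻¹ : X ≃ₜ X).isClosed_image.2 hK, _, ?_, hc.conj k⁻¹⟩
        rw [inv_inv]
        exact H.mul_mem (H.mul_mem (H.inv_mem hk) hg) hk
      obtain ⟨y, hy, hyx⟩ := hx _ this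
      rw [← hyx]
      simpa using hy)
  obtain ⟨g, hg, y, hy, y', hy', hyy, c, hc1, hc0, hcn⟩ :=
    hM.exists_contracting_of_not_preserves hS hloc hH
  obtain ⟨K, hK, hc⟩ := (hloc g hg).exists_collapses
  -- A positive power of `g` moves `y` and `y'` by less than `dist y y'`, so by the ultrametric
  -- inequality it cannot bring them closer, although `g` contracts them.
  have hKF : K ∈ F := ⟨hK, g, hg, hc⟩
  have hMK : M ⊆ K := hMF.trans (Set.sInter_subset_of_mem hKF)
  obtain ⟨R, Φ, -, -, h⟩ := hc
  have hpos : 0 < dist y y' := dist_pos.2 hyy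
  obtain ⟨_, ⟨n, hn, rfl⟩, -, hid⟩ := h (dist y y') hpos
  have h1 := hid y (hMK hy)
  have h2 := hid y' (hMK hy')
  have h3 : dist ((g ^ n) y) ((g ^ n) y') < dist y y' := by
    rw [hcn n]
    have := pow_lt_one₀ hc0.le hc1 (by omega : n ≠ 0)
    nlinarith
  have h4 : dist y y' < dist y y' := by
    rw [dist_comm] at h1
    exact dist_lt_trans (dist_lt_trans h1 h3) h2
  exact lt_irrefl _ h4

/-- The dynamical Tits alternative for groups of local homotheties of compact ultrametric spaces. -/
theorem dynamicalTitsAlternative_of_isLocalHomothety {G : Subgroup (X ≃ₜ X)}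
    (hG : ∀ g ∈ G, IsLocalHomothety g) : DynamicalTitsAlternative G := by
  intro H hHG
  by_contra! hcon
  obtain ⟨hno, hpp⟩ := hcon
  refine hno (preservesRegularProbability_of_closure_finset fun F hF => ?_)
  by_contra hFno
  have hle : Subgroup.closure (F : Set (X ≃ₜ X)) ≤ H := (Subgroup.closure_le H).2 hF
  obtain ⟨g, hg, h, hh, hgh⟩ := exists_isPingPongPair_of_finite F.finite_toSet
    (fun g hg => hG g (hHG (hle hg))) hFno
  exact hpp g (hle hg) h (hle hh) hgh

end TitsAlternative

/-! ### Application to almost automorphisms -/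

theorem RootedTree.isLocalHomothety_of_mem_AAut {T : RootedTree} [T.LocallyFinite]
    {g : T.Boundary ≃ₜ T.Boundary} (hg : g ∈ T.AAut) : IsLocalHomothety g := by
  intro x
  obtain ⟨U, hU, c, hc, h⟩ := RootedTree.isAlmostAutomorphism_iff.1 hg x
  obtain ⟨r, hr, hrU⟩ := Metric.mem_nhds_iff.1 hU
  exact ⟨r, hr, c, hc, fun u v hu hv => h u (hrU hu) v (hrU hv)⟩

theorem theoremA (T : RootedTree) [T.LocallyFinite] [Infinite T] :
    DynamicalTitsAlternative T.AAut ∧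
      ∀ g ∈ T.AAut, ∀ h ∈ T.AAut, IsPingPongPair g h →
        Function.Injective (FreeGroup.lift ![g, h]) :=
  ⟨dynamicalTitsAlternative_of_isLocalHomothety fun _ => RootedTree.isLocalHomothety_of_mem_AAut,
    fun _ _ _ _ => IsPingPongPair.injective_lift⟩
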